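/- Let $s\ge 1$ (number of colors) and $n\ge 1$. Consider the chain of $2n$ sites with Hilbert space $(\mathbb{C}^{2s})^{\otimes 2n}$, each site having the orthonormal basis $u^1,\dots,u^s,d^1,\dots,d^s$ (up and down steps of color $1,\dots,s$). The Fredkin Hamiltonian is $$H=\sum_{j=1}^{2n-2}\Pi_{j,j+1,j+2}+\sum_{j=1}^{2n-1}\Pi^{cross}_{j,j+1}+\Pi_{boundary},$$ where $$\Pi_{j,j+1,j+2}=\sum_{k_1,k_2=1}^{s}\Big(|U^{k_1,k_2}\rangle\langle U^{k_1,k_2}|_{j,j+1,j+2}+|D^{k_1,k_2}\rangle\langle D^{k_1,k_2}|_{j,j+1,j+2}+|\varphi^{k_1,k_2}\rangle\langle\varphi^{k_1,k_2}|_{j,j+1}\Big),$$ $$\Pi^{cross}_{j,j+1}=\sum_{k_1\ne k_2}|u^{k_1}d^{k_2}\rangle\langle u^{k_1}d^{k_2}|_{j,j+1},\qquad \Pi_{boundary}=\sum_{k=1}^{s}\big(|d^k\rangle\langle d^k|_{1}+|u^k\rangle\langle u^k|_{2n}\big),$$ with subscripts denoting the sites acted on (identity on all other sites) and $$|U^{k_1,k_2}\rangle=\tfrac{1}{\sqrt2}\big(|u^{k_1}u^{k_2}d^{k_2}\rangle-|u^{k_2}d^{k_2}u^{k_1}\rangle\big),\quad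 |D^{k_1,k_2}\rangle=\tfrac{1}{\sqrt2}\big(|d^{k_1}u^{k_2}d^{k_2}\rangle-|u^{k_2}d^{k_2}d^{k_1}\rangle\big),\quad |\varphi^{k_1,k_2}\rangle=\tfrac{1}{\sqrt2}\big(|u^{k_1}d^{k_1}\rangle-|u^{k_2}d^{k_2}\rangle\big).$$ A word in the letters $u^k,d^k$ is an $s$-colored Dyck walk if it is empty or of the form $u^k\,v\,d^k\,w$ with $v,w$ $s$-colored Dyck walks. The unbalanced subspace is the span of the basis vectors $|x\rangle$ for all words $x$ of length $2n$ that are not $s$-colored Dyck walks, that is, words with a height imbalance or a color mismatch. Then $H$ maps the unbalanced subspace into itself, and the smallest eigenvalue of the restriction of $H$ to it is at least $n^{-O(1)}$: there are an exponent $c\in\mathbb{N}$ and a constant $C>0$, both independent of $n$ and $s$, such that for all $s\ge 1$ and $n\ge 1$ this smallest eigenvalue is at least $C\,n^{-c}$. -/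

import Mathlib

/-- The `2s` local spin states: `(true, k)` is the up step `u^k` of color `k`, and `(false, k)`
is the down step `d^k` of color `k`. -/
abbrev Step (s : ℕ) : Type := Bool × Fin s

/-- The up step `u^k`. -/
def Step.u {s : ℕ} (k : Fin s) : Step s := (true, k)

/-- The down step `d^k`. -/
def Step.d {s : ℕ} (k : Fin s) : Step s := (false, k)

/-- `s`-colored Dyck words: every up step is closed by a down step of the same color, and
the matched pairs are nested. -/
inductive IsColoredDyck {s : ℕ} : List (Step s) → Prop
  | nil : IsColoredDyck []
  | cons (k : Fin s) (v w : List (Step s)) (hv : IsColoredDyck v) (hw : IsColoredDyck w) :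
      IsColoredDyck (Step.u k :: v ++ Step.d k :: w)

/-- Spin configurations of a chain of `N` sites; they index the standard basis of
`(ℂ^{2s})^{⊗ N}`. Sites are numbered from `0`. -/
abbrev Config (s N : ℕ) : Type := Fin N → Step s

/-- The Hilbert space `(ℂ^{2s})^{⊗ N}`. -/
abbrev ChainSpace (s N : ℕ) : Type := EuclideanSpace ℂ (Config s N)

noncomputable section

/-- The basis vector `|x⟩` on `k` sites. -/
def ket {s k : ℕ} (x : Config s k) : Config s k → ℂ := Pi.single x 1

/-- The rank-one operator `|v⟩⟨v|`. -/
def ketBra {s k : ℕ} (v : Config s k → ℂ) : Matrix (Config s k) (Config s k) ℂ :=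
  Matrix.vecMulVec v (star v)

/-- The operator `M` on `k` sites, acting on the sites `j, …, j + k - 1` of a chain of `N` sites
and as the identity on the other sites (it is `0` if these sites are not all in the chain). -/
def actAt {s k : ℕ} (N j : ℕ) (M : Matrix (Config s k) (Config s k) ℂ) :
    Matrix (Config s N) (Config s N) ℂ :=
  fun x y =>
    if h : j + k ≤ N then
      if ∀ i : Fin N, (i.val < j ∨ j + k ≤ i.val) → x i = y i then
        M (fun a => x ⟨j + a.val, by omega⟩) (fun a => y ⟨j + a.val, by omega⟩)
      else 0
    else 0

/-- `|U^{a,b}⟩ = (|u^a u^b d^b⟩ - |u^b d^b u^a⟩) / √2`. -/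
def vecU {s : ℕ} (a b : Fin s) : Config s 3 → ℂ :=
  (1 / (Real.sqrt 2 : ℂ)) • (ket ![Step.u a, Step.u b, Step.d b] - ket ![Step.u b, Step.d b, Step.u a])

/-- `|D^{a,b}⟩ = (|d^a u^b d^b⟩ - |u^b d^b d^a⟩) / √2`. -/
def vecD {s : ℕ} (a b : Fin s) : Config s 3 → ℂ :=
  (1 / (Real.sqrt 2 : ℂ)) • (ket ![Step.d a, Step.u b, Step.d b] - ket ![Step.u b, Step.d b, Step.d a])

/-- `|φ^{a,b}⟩ = (|u^a d^a⟩ - |u^b d^b⟩) / √2`. -/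
def vecPhi {s : ℕ} (a b : Fin s) : Config s 2 → ℂ :=
  (1 / (Real.sqrt 2 : ℂ)) • (ket ![Step.u a, Step.d a] - ket ![Step.u b, Step.d b])

/-- `Π_{j,j+1,j+2}`; the two-site term `|φ⟩⟨φ|` acts on the sites `j, j+1`. -/
def moveTerm (s N j : ℕ) : Matrix (Config s N) (Config s N) ℂ :=
  ∑ a : Fin s, ∑ b : Fin s,
    (actAt N j (ketBra (vecU a b)) + actAt N j (ketBra (vecD a b)) +
      actAt N j (ketBra (vecPhi a b)))

/-- `Π^{cross}_{j,j+1}`. -/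
def crossTerm (s N j : ℕ) : Matrix (Config s N) (Config s N) ℂ :=
  ∑ a : Fin s, ∑ b : Fin s,
    if a ≠ b then actAt N j (ketBra (ket ![Step.u a, Step.d b])) else 0

/-- `Π_{boundary}`: penalizes a down step at the first site and an up step at the last one. -/
def boundaryTerm (s N : ℕ) : Matrix (Config s N) (Config s N) ℂ :=
  ∑ a : Fin s, (actAt N 0 (ketBra (ket ![Step.d a])) + actAt N (N - 1) (ketBra (ket ![Step.u a])))

/-- The matrix of the Fredkin Hamiltonian on `2n` sites. -/
def fredkinMatrix (s n : ℕ) : Matrix (Config s (2 * n)) (Config s (2 * n)) ℂ :=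
  ∑ j ∈ Finset.range (2 * n - 2), moveTerm s (2 * n) j +
    ∑ j ∈ Finset.range (2 * n - 1), crossTerm s (2 * n) j + boundaryTerm s (2 * n)

/-- The Fredkin Hamiltonian as an operator on `(ℂ^{2s})^{⊗ 2n}`. -/
def fredkinH (s n : ℕ) : ChainSpace s (2 * n) →ₗ[ℂ] ChainSpace s (2 * n) :=
  Matrix.toEuclideanLin (fredkinMatrix s n)

/-- The unbalanced subspace: the span of the basis vectors `|x⟩` for which `x` is not an
`s`-colored Dyck walk. -/
def unbalancedSubspace (s n : ℕ) : Submodule ℂ (ChainSpace s (2 * n)) :=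
  Submodule.span ℂ
    {v | ∃ x : Config s (2 * n), ¬ IsColoredDyck (List.ofFn x) ∧ v = EuclideanSpace.single x 1}

end

/-! Every term of `H` is a nonnegative rank-one operator, so it suffices to bound ‖ψ‖², for ψ in the
unbalanced subspace, by a polynomial in n times the quadratic form of `H`. That form dominates the
penalties and the move energy: the squared changes of ψ when a peak u^k d^k is exchanged with a
neighbouring step. The recoloring terms |φ⟩⟨φ| are simply discarded.

A non-Dyck word has a defect (`dyck_or_defect`): it is A d^a Q, or P u^a A d^b Q with a ≠ b, or P
u^a A, where A is a Dyck word. Carrying A across a single step gives d^a A Q, P u^a d^b A Q or P A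
u^a, and these words are penalized. The task is therefore to compare the weight of ψ on the words P
A c Q with its weight on the words P c B Q, for fixed P, c, Q, with A and B running over Dyck words
of the same length.

The comparison (`sum_left_le_sum_right`) interpolates through words P A c B Q in which A and B share
q peaks. A random rule for growing a leaf on a binary tree, that is, a peak in its word, turns
uniform trees into uniform trees (`sum_grow`). Starting from A and B with q - 1 nodes in total,
growing A or growing B yields two consecutive stages of the interpolation, and the two words differ
by carrying one peak through a common word. A weighted triangle inequality loses only a factor (1 +
1/q)^q ≤ 3 over all q stages, and the Catalan normalizations differ by a factor of order q^4. Colors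
are summed alike on both sides, so s enters no constant.

Summing over all defects overcounts each move only polynomially (`tsum_pairSum_le`), which gives
`tsum_not_dyck_le`. Invariance of the subspace holds because inserting or removing a peak never
changes whether a word is Dyck. -/

namespace Fredkin

/-! ### Colored binary trees and colored Dyck words -/

/-- Binary trees with colored nodes; they parametrize the colored Dyck words. -/
inductive ColorTree (s : ℕ) : Type
  | nil : ColorTree s
  | node (k : Fin s) (l r : ColorTree s) : ColorTree s

namespace ColorTree

variable {s : ℕ}

/-- The number of nodes. -/
def size : ColorTree s → ℕ
  | nil => 0
  | node _ l r => l.size + r.size + 1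

/-- The colored Dyck word of a tree. -/
def word : ColorTree s → List (Step s)
  | nil => []
  | node k l r => Step.u k :: (l.word ++ Step.d k :: r.word)

lemma length_word (t : ColorTree s) : t.word.length = 2 * t.size := by
  induction t with
  | nil => rfl
  | node k l r hl hr => simp [word, size, hl, hr]; ring

lemma isColoredDyck_word (t : ColorTree s) : IsColoredDyck t.word := by
  induction t with
  | nil => exact .nil
  | node k l r hl hr => simpa [word] using IsColoredDyck.cons k _ _ hl hr

lemma exists_word_of_isColoredDyck {w : List (Step s)} (h : IsColoredDyck w) :
    ∃ t : ColorTree s, t.word = w := by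
  induction h with
  | nil => exact ⟨nil, rfl⟩
  | cons k v w _ _ hv hw =>
    obtain ⟨l, rfl⟩ := hv
    obtain ⟨r, rfl⟩ := hw
    exact ⟨node k l r, by simp [word]⟩

/-- The down step after a Dyck prefix is the first unmatched one of the whole word, so it fixes the
parse. Keeping the tails arbitrary lets the induction apply to both subtrees. -/
lemma word_append_d_inj (t t' : ColorTree s) (k k' : Fin s) (R R' : List (Step s))
    (h : t.word ++ Step.d k :: R = t'.word ++ Step.d k' :: R') : t = t' ∧ k = k' ∧ R = R' := by
  induction t generalizing t' k k' R R' with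
  | nil =>
    cases t' with
    | nil => simpa [word, Step.d] using h
    | node => simp [word, Step.d, Step.u] at h
  | node c l r hl hr =>
    cases t' with
    | nil => simp [word, Step.d, Step.u] at h
    | node c' l' r' =>
      simp only [word, List.cons_append, List.append_assoc, List.cons.injEq] at h
      obtain ⟨h1, h2, h3⟩ := hl _ _ _ _ _ h.2
      obtain ⟨h4, h5, h6⟩ := hr _ _ _ _ _ h3
      simp [*]

lemma word_injective : Function.Injective (word : ColorTree s → List (Step s)) := by
  intro t t' h
  cases t with
  | nil => cases t' with
    | nil => rfl
    | node => simp [word] at h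
  | node k l r =>
    exact (word_append_d_inj _ _ k k [] [] (by rw [h])).1

end ColorTree

variable {s : ℕ}

/-- A word is a colored Dyck word, or its matching breaks at an unmatched down step, at a color
mismatch, or at an unmatched up step. -/
lemma dyck_or_defect (x : List (Step s)) :
    (∃ A : ColorTree s, x = A.word) ∨
    (∃ (A : ColorTree s) (a : Fin s) (Q : List (Step s)), x = A.word ++ Step.d a :: Q) ∨
    (∃ (P : List (Step s)) (a b : Fin s) (A : ColorTree s) (Q : List (Step s)), a ≠ b ∧
      x = P ++ Step.u a :: (A.word ++ Step.d b :: Q)) ∨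
    (∃ (P : List (Step s)) (a : Fin s) (A : ColorTree s), x = P ++ Step.u a :: A.word) := by
  induction hn : x.length using Nat.strong_induction_on generalizing x with
  | _ n ih =>
  subst hn
  match x with
  | [] => exact .inl ⟨.nil, rfl⟩
  | (false, a) :: x => exact .inr (.inl ⟨.nil, a, x, rfl⟩)
  | (true, a) :: x =>
    rcases ih _ (by simp) x rfl with ⟨A, rfl⟩ | ⟨A, b, Q, rfl⟩ | ⟨P, b, c, A, Q, h, rfl⟩ |
      ⟨P, b, A, rfl⟩
    · exact .inr (.inr (.inr ⟨[], a, A, rfl⟩))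
    · by_cases hab : a = b
      · subst hab
        rcases ih _ (by simp; omega) Q rfl with ⟨B, rfl⟩ | ⟨B, b, Q, rfl⟩ |
          ⟨P, b, c, B, Q, h, rfl⟩ | ⟨P, b, B, rfl⟩
        · exact .inl ⟨.node a A B, rfl⟩
        · exact .inr (.inl ⟨.node a A B, b, Q, by simp [ColorTree.word, Step.u]⟩)
        · exact .inr (.inr (.inl
            ⟨Step.u a :: (A.word ++ Step.d a :: P), b, c, B, Q, h, by simp [Step.u]⟩))
        · exact .inr (.inr (.inr
            ⟨Step.u a :: (A.word ++ Step.d a :: P), b, B, by simp [Step.u]⟩))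
      · exact .inr (.inr (.inl ⟨[], a, b, A, Q, hab, rfl⟩))
    · exact .inr (.inr (.inl ⟨Step.u a :: P, b, c, A, Q, h, rfl⟩))
    · exact .inr (.inr (.inr ⟨Step.u a :: P, b, A, rfl⟩))

/-! ### A stack automaton for colored Dyck words -/

/-- One step of the stack automaton that recognizes colored Dyck words. -/
def stackStep : Option (List (Fin s)) → Step s → Option (List (Fin s))
  | none, _ => none
  | some st, (true, k) => some (k :: st)
  | some [], (false, _) => none
  | some (a :: st), (false, k) => if a = k then some st else none

/-- The state of the stack automaton after reading a word. -/
def stackRun (o : Option (List (Fin s))) (w : List (Step s)) : Option (List (Fin s)) :=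
  w.foldl stackStep o

lemma stackRun_none (w : List (Step s)) : stackRun none w = none := by
  induction w with
  | nil => rfl
  | cons c w ih => simpa [stackRun, stackStep] using ih

lemma stackRun_append (o : Option (List (Fin s))) (v w : List (Step s)) :
    stackRun o (v ++ w) = stackRun (stackRun o v) w := List.foldl_append

lemma stackRun_cons (o : Option (List (Fin s))) (c : Step s) (w : List (Step s)) :
    stackRun o (c :: w) = stackRun (stackStep o c) w := rfl

lemma stackRun_peak (o : Option (List (Fin s))) (k : Fin s) (w : List (Step s)) :
    stackRun o (Step.u k :: Step.d k :: w) = stackRun o w := by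
  cases o <;> simp [stackRun_cons, stackStep, Step.u, Step.d]

lemma stackRun_word (o : Option (List (Fin s))) (t : ColorTree s) : stackRun o t.word = o := by
  induction t generalizing o with
  | nil => rfl
  | node k l r hl hr =>
    cases o with
    | none => exact stackRun_none _
    | some st =>
      rw [ColorTree.word, stackRun_cons, stackRun_append, hl, stackRun_cons, hr]
      simp [stackStep, Step.u, Step.d]

lemma isColoredDyck_iff_stackRun (w : List (Step s)) :
    IsColoredDyck w ↔ stackRun (some []) w = some [] := by
  constructor
  · intro h
    obtain ⟨t, rfl⟩ := ColorTree.exists_word_of_isColoredDyck h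
    exact stackRun_word _ t
  · intro h
    -- Dyck factors leave the state unchanged, so an unmatched or mismatched down step makes the
    -- automaton fail, and an unmatched up step leaves a nonempty stack unless it has failed
    -- already.
    rcases dyck_or_defect w with ⟨A, rfl⟩ | ⟨A, b, Q, rfl⟩ | ⟨P, b, c, A, Q, hbc, rfl⟩ |
      ⟨P, b, A, rfl⟩
    · exact A.isColoredDyck_word
    · rw [stackRun_append, stackRun_word, stackRun_cons, Step.d, stackStep, stackRun_none] at h
      cases h
    · rw [stackRun_append, stackRun_cons, stackRun_append, stackRun_word, stackRun_cons] at h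
      cases hP : stackRun (some []) P with
      | none => simp [hP, stackStep, stackRun_none] at h
      | some st => simp [hP, stackStep, Step.u, Step.d, hbc, stackRun_none] at h
    · rw [stackRun_append, stackRun_cons, stackRun_word] at h
      cases hP : stackRun (some []) P with
      | none => simp [hP, stackStep] at h
      | some st => simp [hP, stackStep, Step.u] at h

/-- Inserting or removing a peak does not affect being a colored Dyck word. -/
lemma isColoredDyck_peak_iff (P S : List (Step s)) (k : Fin s) :
    IsColoredDyck (P ++ Step.u k :: Step.d k :: S) ↔ IsColoredDyck (P ++ S) := by
  rw [isColoredDyck_iff_stackRun, isColoredDyck_iff_stackRun, stackRun_append, stackRun_append,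
    stackRun_peak]

end Fredkin

namespace Fredkin

/-! ### Uniform growth of trees by leaves -/

namespace ColorTree

variable {s : ℕ}

lemma finite_size_eq (s n : ℕ) : {t : ColorTree s | t.size = n}.Finite :=
  ((List.finite_length_eq (Step s) (2 * n)).preimage word_injective.injOn).subset
    fun t ht => by
      simp only [Set.mem_ofPred_eq] at ht
      simp [length_word, ht]

/-- The trees with `n` nodes. -/
noncomputable def ofSize (s n : ℕ) : Finset (ColorTree s) := (finite_size_eq s n).toFinset

@[simp] lemma mem_ofSize {n : ℕ} {t : ColorTree s} : t ∈ ofSize s n ↔ t.size = n := by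
  simp [ofSize]

lemma ofSize_zero : ofSize s 0 = {nil} := by
  ext t
  cases t <;> simp [size]

lemma sum_ofSize_succ {M : Type*} [AddCommMonoid M] (n : ℕ) (φ : ColorTree s → M) :
    ∑ t ∈ ofSize s (n + 1), φ t =
      ∑ c, ∑ p ∈ Finset.HasAntidiagonal.antidiagonal n, ∑ l ∈ ofSize s p.1, ∑ r ∈ ofSize s p.2,
        φ (node c l r) := by
  simp_rw [Finset.sum_sigma']
  symm
  refine Finset.sum_bij (fun x _ => node x.1 x.2.2.1 x.2.2.2) ?_ ?_ ?_ ?_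
  · rintro ⟨c, ⟨i, j⟩, l, r⟩ h
    simp only [Finset.mem_sigma, Finset.mem_univ, true_and, Finset.HasAntidiagonal.mem_antidiagonal,
      mem_ofSize] at h
    simp only [mem_ofSize, size]
    omega
  · rintro ⟨c, ⟨i, j⟩, l, r⟩ h ⟨c', ⟨i', j'⟩, l', r'⟩ h' heq
    simp only [Finset.mem_sigma, Finset.mem_univ, true_and, Finset.HasAntidiagonal.mem_antidiagonal,
      mem_ofSize] at h h'
    simp only [node.injEq] at heq
    obtain ⟨rfl, rfl, rfl⟩ := heq
    obtain ⟨-, rfl, rfl⟩ := h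
    obtain ⟨-, rfl, rfl⟩ := h'
    rfl
  · rintro t ht
    cases t with
    | nil => simp [size] at ht
    | node c l r =>
      refine ⟨⟨c, (l.size, r.size), l, r⟩, ?_, rfl⟩
      simpa [size] using ht
  · intros
    rfl

/-- The probability with which a new leaf goes into the left one of two subtrees of sizes `l` and
`r`. -/
noncomputable def leftProb (l r : ℕ) : ℝ :=
  (l + 1) * (2 * l + 1) * (l + 3 * r + 3) / ((l + r + 1) * (l + r + 2) * (2 * (l + r) + 3))

lemma leftProb_nonneg (l r : ℕ) : 0 ≤ leftProb l r := by
  unfold leftProb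
  positivity

lemma leftProb_add_leftProb (l r : ℕ) : leftProb l r + leftProb r l = 1 := by
  unfold leftProb
  field_simp
  ring

/-- The expectation of `φ` over the trees obtained from a tree by growing a random leaf of
color `k`. -/
noncomputable def grow (k : Fin s) : ColorTree s → (ColorTree s → ℝ) → ℝ
  | nil, φ => φ (node k nil nil)
  | node c l r, φ =>
    leftProb l.size r.size * grow k l (fun l' => φ (node c l' r)) +
      leftProb r.size l.size * grow k r (fun r' => φ (node c l r'))

lemma grow_add (k : Fin s) (t : ColorTree s) (φ χ : ColorTree s → ℝ) :
    grow k t (fun x => φ x + χ x) = grow k t φ + grow k t χ := by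
  induction t generalizing φ χ with
  | nil => rfl
  | node c l r hl hr => simp only [grow, hl, hr]; ring

lemma grow_mul (k : Fin s) (t : ColorTree s) (a : ℝ) (φ : ColorTree s → ℝ) :
    grow k t (fun x => a * φ x) = a * grow k t φ := by
  induction t generalizing φ with
  | nil => rfl
  | node c l r hl hr => simp only [grow, hl, hr]; ring

lemma grow_const (k : Fin s) (t : ColorTree s) (a : ℝ) : grow k t (fun _ => a) = a := by
  induction t with
  | nil => rfl
  | node c l r hl hr => simp only [grow, hl, hr]; rw [← add_mul, leftProb_add_leftProb, one_mul]

/-- The word of `x` arises from that of `t` by inserting a peak of color `k`. -/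
def PeakInsertion (k : Fin s) (t x : ColorTree s) : Prop :=
  ∃ V W : List (Step s), t.word = V ++ W ∧ x.word = V ++ Step.u k :: Step.d k :: W

/-- Growth replaces one empty subtree by a leaf, which inserts a peak in the word; only such trees
enter the expectation. -/
lemma grow_mono {k : Fin s} {t : ColorTree s} {φ χ : ColorTree s → ℝ}
    (h : ∀ x, PeakInsertion k t x → φ x ≤ χ x) : grow k t φ ≤ grow k t χ := by
  induction t generalizing φ χ with
  | nil => exact h _ ⟨[], [], rfl, rfl⟩
  | node c l r hl hr =>
    refine add_le_add (mul_le_mul_of_nonneg_left (hl fun x hx => h _ ?_) (leftProb_nonneg _ _))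
      (mul_le_mul_of_nonneg_left (hr fun x hx => h _ ?_) (leftProb_nonneg _ _))
    · obtain ⟨V, W, h1, h2⟩ := hx
      exact ⟨Step.u c :: V, W ++ Step.d c :: r.word, by simp [word, h1], by simp [word, h2]⟩
    · obtain ⟨V, W, h1, h2⟩ := hx
      exact ⟨Step.u c :: (l.word ++ Step.d c :: V), W, by simp [word, h1], by simp [word, h2]⟩

lemma grow_sum {ι : Type*} (S : Finset ι) (k : Fin s) (t : ColorTree s)
    (φ : ι → ColorTree s → ℝ) :
    grow k t (fun x => ∑ i ∈ S, φ i x) = ∑ i ∈ S, grow k t (φ i) := by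
  classical
  induction S using Finset.induction_on with
  | empty => simpa using grow_const k t 0
  | insert a S ha ih => simp only [Finset.sum_insert ha, grow_add, ih]

/-- Growing a leaf of random color turns uniform random trees into uniform random trees. -/
lemma sum_grow (n : ℕ) (φ : ColorTree s → ℝ) :
    ∑ k, ∑ t ∈ ofSize s n, grow k t φ =
      (n + 2) / (2 * (2 * n + 1)) * ∑ t ∈ ofSize s (n + 1), φ t := by
  induction n using Nat.strong_induction_on generalizing φ with
  | _ n ih =>
  cases n with
  | zero => simp [ofSize_zero, grow, sum_ofSize_succ]
  | succ m =>
    set Φ : Fin s → ℕ × ℕ → ℝ := fun c p =>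
      ∑ l ∈ ofSize s p.1, ∑ r ∈ ofSize s p.2, φ (node c l r) with hΦ
    -- The coefficient that growth on the left gives to a pair of subtrees, indexed by sizes after
    -- growth. Its factor `p.1` kills the pairs with empty left subtree, so the sum extends to the
    -- full antidiagonal.
    set α : ℕ × ℕ → ℝ := fun p => p.1 * (p.1 + 1) * (p.1 + 3 * p.2 + 2) /
      (2 * (m + 1) * (m + 2) * (2 * m + 3)) with hα
    have h1 : ∀ c, ∑ p ∈ Finset.HasAntidiagonal.antidiagonal m, leftProb p.1 p.2 *
        ∑ k, ∑ l ∈ ofSize s p.1, ∑ r ∈ ofSize s p.2, grow k l (fun l' => φ (node c l' r)) =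
        ∑ p ∈ Finset.HasAntidiagonal.antidiagonal (m + 1), α p * Φ c p := by
      intro c
      rw [Finset.Nat.sum_antidiagonal_succ]
      simp only [hα, Nat.cast_zero, zero_mul, zero_div, zero_add]
      refine Finset.sum_congr rfl fun p hp => ?_
      rw [Finset.HasAntidiagonal.mem_antidiagonal] at hp
      have : ∑ k, ∑ l ∈ ofSize s p.1, ∑ r ∈ ofSize s p.2, grow k l (fun l' => φ (node c l' r)) =
          (p.1 + 2) / (2 * (2 * p.1 + 1)) * Φ c (p.1 + 1, p.2) := by
        simp only [← grow_sum]
        rw [ih p.1 (by omega)]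
      rw [this, ← hp, leftProb]
      push_cast
      field_simp
      ring
    have h2 : ∀ c, ∑ p ∈ Finset.HasAntidiagonal.antidiagonal m, leftProb p.2 p.1 *
        ∑ k, ∑ l ∈ ofSize s p.1, ∑ r ∈ ofSize s p.2, grow k r (fun r' => φ (node c l r')) =
        ∑ p ∈ Finset.HasAntidiagonal.antidiagonal (m + 1), α p.swap * Φ c p := by
      intro c
      rw [Finset.Nat.sum_antidiagonal_succ']
      simp only [hα, Nat.cast_zero, zero_mul, zero_div, zero_add, Prod.swap]
      refine Finset.sum_congr rfl fun p hp => ?_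
      rw [Finset.HasAntidiagonal.mem_antidiagonal] at hp
      have : ∑ k, ∑ l ∈ ofSize s p.1, ∑ r ∈ ofSize s p.2, grow k r (fun r' => φ (node c l r')) =
          (p.2 + 2) / (2 * (2 * p.2 + 1)) * Φ c (p.1, p.2 + 1) := by
        simp only [hΦ]
        rw [Finset.sum_comm, Finset.mul_sum]
        exact Finset.sum_congr rfl fun l _ => ih p.2 (by omega) _
      rw [this, ← hp, leftProb]
      push_cast
      field_simp
      ring
    have h3 : ∑ k, ∑ t ∈ ofSize s (m + 1), grow k t φ =
        ∑ c, (∑ p ∈ Finset.HasAntidiagonal.antidiagonal m, leftProb p.1 p.2 *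
          ∑ k, ∑ l ∈ ofSize s p.1, ∑ r ∈ ofSize s p.2, grow k l (fun l' => φ (node c l' r)) +
        ∑ p ∈ Finset.HasAntidiagonal.antidiagonal m, leftProb p.2 p.1 *
          ∑ k, ∑ l ∈ ofSize s p.1, ∑ r ∈ ofSize s p.2, grow k r (fun r' => φ (node c l r'))) := by
      simp only [sum_ofSize_succ]
      rw [Finset.sum_comm]
      refine Finset.sum_congr rfl fun c _ => ?_
      rw [Finset.sum_comm, ← Finset.sum_add_distrib]
      refine Finset.sum_congr rfl fun p _ => ?_
      simp only [Finset.mul_sum, ← Finset.sum_add_distrib]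
      refine Finset.sum_congr rfl fun k _ => Finset.sum_congr rfl fun l hl =>
        Finset.sum_congr rfl fun r hr => ?_
      rw [mem_ofSize] at hl hr
      simp only [grow, hl, hr]
    rw [h3, sum_ofSize_succ, Finset.mul_sum]
    refine Finset.sum_congr rfl fun c _ => ?_
    rw [h1, h2, ← Finset.sum_add_distrib, Finset.mul_sum]
    refine Finset.sum_congr rfl fun p hp => ?_
    rw [Finset.HasAntidiagonal.mem_antidiagonal] at hp
    -- The choice of `leftProb` pays off here: i(i+1)(i+3j+2) + j(j+1)(j+3i+2) = M(M+1)(M+2) with M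
    -- = i + j, so the total coefficient does not depend on the split.
    rw [← add_mul]
    congr 1
    have hm : (m : ℝ) = p.1 + p.2 - 1 := by
      rw [eq_sub_iff_add_eq]
      exact_mod_cast hp.symm
    have hm0 : (0 : ℝ) ≤ m := m.cast_nonneg
    simp only [hα, Prod.fst_swap, Prod.snd_swap, Nat.cast_add, Nat.cast_one]
    have h4 : (2 * ((m : ℝ) + 1) + 1) = 2 * m + 3 := by ring
    rw [h4]
    have h5 : (0 : ℝ) < 2 * m + 3 := by positivity
    rw [← add_div, div_eq_div_iff (by positivity) (by positivity), hm]
    ring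

end ColorTree

/-! ### Comparison of the two ends of a split pair of trees -/

lemma catalan_pos (n : ℕ) : 0 < catalan n :=
  pos_of_mul_pos_right (by rw [succ_mul_catalan_eq_centralBinom]; exact n.centralBinom_pos)
    (Nat.zero_le (n + 1))

/-- The ratio of consecutive Catalan numbers is exactly the constant in `sum_grow`, so growth
preserves sums normalized by Catalan numbers. -/
lemma add_two_mul_catalan_succ (n : ℕ) :
    (n + 2) * catalan (n + 1) = 2 * (2 * n + 1) * catalan n := by
  have h := n.succ_mul_centralBinom_succ
  rw [← succ_mul_catalan_eq_centralBinom, ← succ_mul_catalan_eq_centralBinom] at h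
  have h' : (n + 1) * ((n + 2) * catalan (n + 1)) = (n + 1) * (2 * (2 * n + 1) * catalan n) := by
    linear_combination h
  exact Nat.eq_of_mul_eq_mul_left n.succ_pos h'

lemma catalan_le_four_pow (n : ℕ) : catalan n ≤ 4 ^ n :=
  calc catalan n ≤ (n + 1) * catalan n := Nat.le_mul_of_pos_left _ n.succ_pos
    _ = n.centralBinom := succ_mul_catalan_eq_centralBinom n
    _ ≤ 4 ^ n := by
      rw [Nat.centralBinom, show 4 ^ n = 2 ^ (2 * n) by rw [pow_mul]; norm_num]
      exact Nat.choose_le_two_pow _ _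

lemma four_pow_le_mul_catalan (n : ℕ) : 4 ^ n ≤ 2 * (n + 1) ^ 2 * catalan n := by
  rcases n.eq_zero_or_pos with rfl | hn
  · simp
  · calc 4 ^ n ≤ 2 * n * n.centralBinom := Nat.four_pow_le_two_mul_self_mul_centralBinom n hn
      _ ≤ 2 * (n + 1) * n.centralBinom := by gcongr; omega
      _ = _ := by rw [← succ_mul_catalan_eq_centralBinom]; ring

/-- Up to polynomial factors the Catalan number of n is 4^n, and this is multiplicative. -/
lemma catalan_succ_le (i j : ℕ) :
    catalan (i + j + 1) ≤ 16 * (i + j + 1) ^ 4 * (catalan i * catalan j) :=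
  calc catalan (i + j + 1) ≤ 4 ^ (i + j + 1) := catalan_le_four_pow _
    _ = 4 * (4 ^ i * 4 ^ j) := by ring
    _ ≤ 4 * ((2 * (i + 1) ^ 2 * catalan i) * (2 * (j + 1) ^ 2 * catalan j)) := by
      gcongr <;> exact four_pow_le_mul_catalan _
    _ ≤ 4 * ((2 * (i + j + 1) ^ 2 * catalan i) * (2 * (i + j + 1) ^ 2 * catalan j)) := by
      gcongr <;> omega
    _ = _ := by ring

/-- Young's inequality for the cross term. The inequality is iterated q times, so the coefficient of
‖y‖² has to be close to 1. -/
lemma norm_sq_le_weighted {E : Type*} [SeminormedAddCommGroup E] (x y : E) {t : ℝ} (ht : 0 < t) :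
    ‖x‖ ^ 2 ≤ (1 + t) * ‖y‖ ^ 2 + (1 + 1 / t) * ‖x - y‖ ^ 2 := by
  have h1 : ‖x‖ ≤ ‖y‖ + ‖x - y‖ := by
    simpa using norm_add_le y (x - y)
  have h2 : ‖x‖ ^ 2 ≤ (‖y‖ + ‖x - y‖) ^ 2 := by gcongr
  have h3 : 0 ≤ (t * ‖y‖ - ‖x - y‖) ^ 2 / t := by positivity
  have h4 : (t * ‖y‖ - ‖x - y‖) ^ 2 / t =
      t * ‖y‖ ^ 2 - 2 * ‖y‖ * ‖x - y‖ + 1 / t * ‖x - y‖ ^ 2 := by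
    field_simp
    ring
  linarith

open ColorTree

variable {s : ℕ}

/-- The total weight of `f` on pairs of trees of given sizes. -/
noncomputable def pairWeight (f : ColorTree s → ColorTree s → ℂ) (a b : ℕ) : ℝ :=
  ∑ A ∈ ofSize s a, ∑ B ∈ ofSize s b, ‖f A B‖ ^ 2

/-- One stage of the interpolation: uniform A and B are coupled with both of their grown versions,
with the same new color k, and `e` bounds the difference whichever leaves are chosen. -/
lemma pairWeight_succ_le (f : ColorTree s → ColorTree s → ℂ)
    (e : Fin s → ColorTree s → ColorTree s → ℝ)
    (he : ∀ k A B A' B', PeakInsertion k A A' → PeakInsertion k B B' →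
      ‖f A' B - f A B'‖ ^ 2 ≤ e k A B) (a b : ℕ) {t : ℝ} (ht : 0 < t) :
    pairWeight f (a + 1) b / (catalan (a + 1) * catalan b) ≤
      (1 + t) * (pairWeight f a (b + 1) / (catalan a * catalan (b + 1))) +
      (1 + 1 / t) * ((∑ A ∈ ofSize s a, ∑ B ∈ ofSize s b, ∑ k, e k A B) /
        (catalan a * catalan b)) := by
  have hcat : ∀ n : ℕ, ((n : ℝ) + 2) / (2 * (2 * n + 1)) = catalan n / catalan (n + 1) := by
    intro n
    have := catalan_pos (n + 1)
    rw [div_eq_div_iff (by positivity) (by positivity)]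
    exact_mod_cast (add_two_mul_catalan_succ n).trans (by ring)
  have h1 : ∑ A ∈ ofSize s a, ∑ B ∈ ofSize s b, ∑ k, grow k A (fun A' => ‖f A' B‖ ^ 2) =
      catalan a / catalan (a + 1) * pairWeight f (a + 1) b := by
    calc _ = ∑ B ∈ ofSize s b, ∑ k, ∑ A ∈ ofSize s a, grow k A (fun A' => ‖f A' B‖ ^ 2) := by
          rw [Finset.sum_comm]
          exact Finset.sum_congr rfl fun B _ => Finset.sum_comm
      _ = _ := by
          simp only [sum_grow, hcat]
          rw [← Finset.mul_sum, Finset.sum_comm]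
          rfl
  have h2 : ∑ A ∈ ofSize s a, ∑ B ∈ ofSize s b, ∑ k, grow k B (fun B' => ‖f A B'‖ ^ 2) =
      catalan b / catalan (b + 1) * pairWeight f a (b + 1) := by
    calc _ = ∑ A ∈ ofSize s a, ∑ k, ∑ B ∈ ofSize s b, grow k B (fun B' => ‖f A B'‖ ^ 2) :=
          Finset.sum_congr rfl fun B _ => Finset.sum_comm
      _ = _ := by
          simp only [sum_grow, hcat]
          rw [← Finset.mul_sum]
          rfl
  have h3 : ∀ A B k, grow k A (fun A' => ‖f A' B‖ ^ 2) ≤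
      (1 + t) * grow k B (fun B' => ‖f A B'‖ ^ 2) + (1 + 1 / t) * e k A B := by
    intro A B k
    calc grow k A (fun A' => ‖f A' B‖ ^ 2)
        ≤ grow k A (fun _ => (1 + t) * grow k B (fun B' => ‖f A B'‖ ^ 2) +
            (1 + 1 / t) * e k A B) := by
          refine grow_mono fun A' hA' => ?_
          calc ‖f A' B‖ ^ 2 = grow k B (fun _ => ‖f A' B‖ ^ 2) := (grow_const _ _ _).symm
            _ ≤ grow k B (fun B' => (1 + t) * ‖f A B'‖ ^ 2 + (1 + 1 / t) * e k A B) :=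
              grow_mono fun B' hB' => (norm_sq_le_weighted _ (f A B') ht).trans (by
                gcongr
                exact he k A B A' B' hA' hB')
            _ = _ := by rw [grow_add, grow_mul, grow_const]
      _ = _ := grow_const _ _ _
  have h4 := Finset.sum_le_sum fun A (_ : A ∈ ofSize s a) =>
    Finset.sum_le_sum fun B (_ : B ∈ ofSize s b) =>
      Finset.sum_le_sum fun k (_ : k ∈ Finset.univ) => h3 A B k
  simp only [Finset.sum_add_distrib, ← Finset.mul_sum] at h4
  rw [h1, h2] at h4
  have ha : (0 : ℝ) < catalan a := mod_cast catalan_pos a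
  have hb : (0 : ℝ) < catalan b := mod_cast catalan_pos b
  have ha' : (0 : ℝ) < catalan (a + 1) := mod_cast catalan_pos (a + 1)
  have hb' : (0 : ℝ) < catalan (b + 1) := mod_cast catalan_pos (b + 1)
  have h5 := div_le_div_of_nonneg_right h4 (by positivity : (0 : ℝ) ≤ catalan a * catalan b)
  generalize pairWeight f a (b + 1) = x at h5 ⊢
  generalize pairWeight f (a + 1) b = z at h5 ⊢
  generalize (∑ A ∈ ofSize s a, ∑ B ∈ ofSize s b, ∑ k, e k A B) = y at h5 ⊢
  refine le_of_eq_of_le ?_ (h5.trans_eq ?_)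
  · field_simp
  · field_simp

/-- The weight of `f` on the pairs `(A, ∅)` is controlled by that on the pairs `(∅, B)` and
the change of `f` when a peak is carried from the first tree to the second. -/
theorem sum_left_le_sum_right (f : ColorTree s → ColorTree s → ℂ)
    (e : Fin s → ColorTree s → ColorTree s → ℝ) (he0 : ∀ k A B, 0 ≤ e k A B)
    (he : ∀ k A B A' B', PeakInsertion k A A' → PeakInsertion k B B' →
      ‖f A' B - f A B'‖ ^ 2 ≤ e k A B) (q : ℕ) :
    ∑ A ∈ ofSize s q, ‖f A nil‖ ^ 2 ≤ 48 * (q + 1) ^ 5 * (∑ B ∈ ofSize s q, ‖f nil B‖ ^ 2 +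
      ∑ i ∈ Finset.range q, ∑ A ∈ ofSize s i, ∑ B ∈ ofSize s (q - 1 - i), ∑ k, e k A B) := by
  set D : ℕ → ℝ := fun i => ∑ A ∈ ofSize s i, ∑ B ∈ ofSize s (q - 1 - i), ∑ k, e k A B with hD
  have hD0 : ∀ i, 0 ≤ D i := fun i => Finset.sum_nonneg fun A _ => Finset.sum_nonneg fun B _ =>
    Finset.sum_nonneg fun k _ => he0 k A B
  rcases q.eq_zero_or_pos with rfl | hq
  · simp only [ofSize_zero, Finset.sum_singleton, Finset.range_zero, Finset.sum_empty]
    norm_num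
    linarith [sq_nonneg ‖f nil nil‖]
  have hq' : (0 : ℝ) < q := by exact_mod_cast hq
  have key : ∀ a ≤ q, pairWeight f a (q - a) / (catalan a * catalan (q - a)) ≤
      (1 + 1 / (q : ℝ)) ^ a * (pairWeight f 0 q / catalan q + (1 + q) *
        ∑ i ∈ Finset.range a, D i / (catalan i * catalan (q - 1 - i))) := by
    intro a
    induction a with
    | zero => simp
    | succ a ih =>
      intro ha
      -- With t = 1/q the main term grows by (1 + 1/q)^q ≤ 3 in total, while the energy of each
      -- stage is multiplied by 1 + q only.
      have h1 := pairWeight_succ_le f e he a (q - 1 - a) (t := 1 / (q : ℝ)) (by positivity)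
      rw [show q - 1 - a + 1 = q - a by omega, one_div_one_div] at h1
      rw [show q - (a + 1) = q - 1 - a by omega]
      refine h1.trans ?_
      rw [Finset.sum_range_succ, mul_add (1 + (q : ℝ)), ← add_assoc, mul_add, pow_succ']
      have h2 : (1 : ℝ) ≤ (1 + 1 / (q : ℝ)) * (1 + 1 / (q : ℝ)) ^ a := by
        rw [← pow_succ']
        exact one_le_pow₀ (by simp)
      have h3 : 0 ≤ (1 + (q : ℝ)) * (D a / (catalan a * catalan (q - 1 - a))) := by
        have := hD0 a
        positivity
      have h4 := mul_le_mul_of_nonneg_left (ih (by omega))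
        (by positivity : 0 ≤ 1 + 1 / (q : ℝ))
      have h5 := le_mul_of_one_le_left h3 h2
      rw [mul_assoc] at h5 ⊢
      exact add_le_add h4 (by simpa only [mul_assoc] using h5)
  have hexp : (1 + 1 / (q : ℝ)) ^ q ≤ 3 := by
    calc (1 + 1 / (q : ℝ)) ^ q ≤ (Real.exp (1 / q)) ^ q := by
          gcongr
          rw [add_comm]
          exact Real.add_one_le_exp _
      _ = Real.exp 1 := by rw [← Real.exp_nat_mul]; field_simp
      _ ≤ 3 := by linarith [Real.exp_one_lt_d9]
  have hcat := catalan_pos q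
  have h1 := key q le_rfl
  have hW0 : 0 ≤ pairWeight f 0 q :=
    Finset.sum_nonneg fun _ _ => Finset.sum_nonneg fun _ _ => by positivity
  -- The normalization of each stage is replaced by the common `catalan q`, which then cancels.
  have hD1 : ∀ i ∈ Finset.range q, D i / (catalan i * catalan (q - 1 - i)) ≤
      16 * q ^ 4 / catalan q * D i := by
    intro i hi
    rw [Finset.mem_range] at hi
    have h2 := catalan_succ_le i (q - 1 - i)
    rw [show i + (q - 1 - i) + 1 = q by omega] at h2
    have h2' : (catalan q : ℝ) ≤ 16 * q ^ 4 * (catalan i * catalan (q - 1 - i)) := by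
      exact_mod_cast h2
    have hi := catalan_pos i
    have hj := catalan_pos (q - 1 - i)
    rw [div_eq_inv_mul]
    refine mul_le_mul_of_nonneg_right ?_ (hD0 i)
    rw [inv_le_iff_one_le_mul₀ (by positivity), div_mul_eq_mul_div, one_le_div (by positivity)]
    exact h2'
  rw [Nat.sub_self, catalan_zero, Nat.cast_one, mul_one, div_le_iff₀ (by positivity)] at h1
  have hl : pairWeight f q 0 = ∑ A ∈ ofSize s q, ‖f A nil‖ ^ 2 := by
    simp [pairWeight, ofSize_zero]
  have hr : pairWeight f 0 q = ∑ B ∈ ofSize s q, ‖f nil B‖ ^ 2 := by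
    simp [pairWeight, ofSize_zero]
  rw [← hl, ← hr]
  have hDs : 0 ≤ ∑ i ∈ Finset.range q, D i := Finset.sum_nonneg fun i _ => hD0 i
  have h2 : ∑ i ∈ Finset.range q, D i / (catalan i * catalan (q - 1 - i)) ≤
      16 * q ^ 4 / catalan q * ∑ i ∈ Finset.range q, D i := by
    rw [Finset.mul_sum]
    exact Finset.sum_le_sum hD1
  have h3 : 0 ≤ ∑ i ∈ Finset.range q, D i / (catalan i * catalan (q - 1 - i)) :=
    Finset.sum_nonneg fun i _ => div_nonneg (hD0 i) (by positivity)
  have hcat' : (0 : ℝ) < catalan q := mod_cast hcat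
  change _ ≤ 48 * ((q : ℝ) + 1) ^ 5 * (_ + ∑ i ∈ Finset.range q, D i)
  generalize ∑ i ∈ Finset.range q, D i = y at *
  generalize pairWeight f 0 q = x at *
  generalize pairWeight f q 0 = z at *
  generalize ∑ i ∈ Finset.range q, D i / (catalan i * catalan (q - 1 - i)) = w at *
  generalize (1 + 1 / (q : ℝ)) ^ q = v at *
  generalize (catalan q : ℝ) = c at *
  have h4 : v * (x / c + (1 + q) * w) ≤ 3 * (x / c + (1 + q) * (16 * q ^ 4 / c * y)) :=
    mul_le_mul hexp (by gcongr) (by positivity) (by norm_num)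
  have h5 : z ≤ 3 * x + 48 * ((1 + q) * q ^ 4) * y := by
    refine (h1.trans (mul_le_mul_of_nonneg_right h4 hcat'.le)).trans_eq ?_
    field_simp
    ring
  have h6 : (1 : ℝ) ≤ ((q : ℝ) + 1) ^ 5 := one_le_pow₀ (by linarith)
  have h7 : (1 + (q : ℝ)) * q ^ 4 ≤ (q + 1) ^ 5 :=
    calc (1 + (q : ℝ)) * q ^ 4 ≤ (1 + q) * (q + 1) ^ 4 := by gcongr; linarith
      _ = _ := by ring
  calc z ≤ 3 * x + 48 * ((1 + q) * q ^ 4) * y := h5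
    _ ≤ 48 * (q + 1) ^ 5 * x + 48 * (q + 1) ^ 5 * y := by
      refine add_le_add (mul_le_mul_of_nonneg_right (by linarith) hW0)
        (mul_le_mul_of_nonneg_right (by linarith) hDs)
    _ = _ := by ring

end Fredkin

namespace Fredkin

/-! ### Carrying a peak through a word -/

variable {s : ℕ}

/-- The word `W` with a peak of color `k` inserted at position `i`. -/
def insertPeak (k : Fin s) (W : List (Step s)) (i : ℕ) : List (Step s) :=
  W.take i ++ Step.u k :: Step.d k :: W.drop i

lemma insertPeak_append (k : Fin s) (V W : List (Step s)) :
    insertPeak k (V ++ W) V.length = V ++ Step.u k :: Step.d k :: W := by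
  simp [insertPeak]

lemma length_insertPeak (k : Fin s) (W : List (Step s)) (i : ℕ) :
    (insertPeak k W i).length = W.length + 2 := by
  simp only [insertPeak, List.length_append, List.length_take, List.length_cons, List.length_drop]
  omega

/-- The energy of carrying a peak of color `k` step by step through `W`. -/
noncomputable def carryEnergy (ψ : List (Step s) → ℂ) (k : Fin s) (W : List (Step s)) : ℝ :=
  ∑ i ∈ Finset.range W.length, ‖ψ (insertPeak k W i) - ψ (insertPeak k W (i + 1))‖ ^ 2

lemma carryEnergy_nonneg (ψ : List (Step s) → ℂ) (k : Fin s) (W : List (Step s)) :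
    0 ≤ carryEnergy ψ k W := Finset.sum_nonneg fun _ _ => by positivity

lemma carryEnergy_eq_zero {N : ℕ} {ψ : List (Step s) → ℂ} (hψ : ∀ w, w.length ≠ N → ψ w = 0)
    (k : Fin s) {W : List (Step s)} (hW : W.length + 2 ≠ N) : carryEnergy ψ k W = 0 := by
  refine Finset.sum_eq_zero fun i _ => ?_
  rw [hψ _ (by rwa [length_insertPeak]), hψ _ (by rwa [length_insertPeak])]
  simp

/-- Cauchy–Schwarz along a path of at most N exchanges. If the words do not have length N, both
sides vanish. -/
lemma norm_insertPeak_sub_sq_le {N : ℕ} {ψ : List (Step s) → ℂ}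
    (hψ : ∀ w, w.length ≠ N → ψ w = 0) (k : Fin s) (W : List (Step s)) {i j : ℕ} (hij : i ≤ j)
    (hj : j ≤ W.length) :
    ‖ψ (insertPeak k W i) - ψ (insertPeak k W j)‖ ^ 2 ≤ N * carryEnergy ψ k W := by
  by_cases hW : W.length + 2 = N
  · have h1 := dist_le_Ico_sum_dist (fun i => ψ (insertPeak k W i)) hij
    simp only [dist_eq_norm] at h1
    calc ‖ψ (insertPeak k W i) - ψ (insertPeak k W j)‖ ^ 2
        ≤ (∑ m ∈ Finset.Ico i j, ‖ψ (insertPeak k W m) - ψ (insertPeak k W (m + 1))‖) ^ 2 := by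
          gcongr
      _ ≤ (Finset.Ico i j).card *
          ∑ m ∈ Finset.Ico i j, ‖ψ (insertPeak k W m) - ψ (insertPeak k W (m + 1))‖ ^ 2 :=
          sq_sum_le_card_mul_sum_sq
      _ ≤ N * carryEnergy ψ k W := by
          refine mul_le_mul ?_ ?_ (Finset.sum_nonneg fun _ _ => by positivity) (by positivity)
          · rw [Nat.card_Ico]
            exact_mod_cast (by omega : j - i ≤ N)
          · refine Finset.sum_le_sum_of_subset_of_nonneg ?_ fun _ _ _ => by positivity
            intro m hm
            rw [Finset.mem_Ico] at hm
            rw [Finset.mem_range]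
            omega
  · rw [hψ _ (by rwa [length_insertPeak]), hψ _ (by rwa [length_insertPeak]),
      carryEnergy_eq_zero hψ k hW]
    simp

open ColorTree

/-- Both words come from P A c B Q by inserting the same peak, once inside A and once inside B. -/
lemma norm_carry_sub_sq_le {N : ℕ} {ψ : List (Step s) → ℂ}
    (hψ : ∀ w, w.length ≠ N → ψ w = 0) (P Q : List (Step s)) (c : Step s) (k : Fin s)
    {A B A' B' : ColorTree s} (hA : PeakInsertion k A A') (hB : PeakInsertion k B B') :
    ‖ψ (P ++ (A'.word ++ c :: (B.word ++ Q))) - ψ (P ++ (A.word ++ c :: (B'.word ++ Q)))‖ ^ 2 ≤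
      N * carryEnergy ψ k (P ++ (A.word ++ c :: (B.word ++ Q))) := by
  obtain ⟨V, W, h1, h2⟩ := hA
  obtain ⟨X, Y, h3, h4⟩ := hB
  have h5 : P ++ (A'.word ++ c :: (B.word ++ Q)) =
      insertPeak k (P ++ (A.word ++ c :: (B.word ++ Q))) (P ++ V).length := by
    have := insertPeak_append k (P ++ V) (W ++ c :: (B.word ++ Q))
    simp only [h1, h2, List.append_assoc, List.cons_append] at this ⊢
    exact this.symm
  have h6 : P ++ (A.word ++ c :: (B'.word ++ Q)) =
      insertPeak k (P ++ (A.word ++ c :: (B.word ++ Q))) (P ++ (A.word ++ c :: X)).length := by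
    have := insertPeak_append k (P ++ (A.word ++ c :: X)) (Y ++ Q)
    simp only [h3, h4, List.append_assoc, List.cons_append] at this ⊢
    exact this.symm
  rw [h5, h6]
  refine norm_insertPeak_sub_sq_le hψ k _ ?_ ?_
  · simp only [h1, List.length_append]
    omega
  · simp only [h3, List.length_append, List.length_cons]
    omega

/-! ### Sums over words -/

open scoped ENNReal

lemma tsum_tree_eq (φ : ColorTree s → ℝ≥0∞) :
    ∑' A, φ A = ∑' q, ∑ A ∈ ofSize s q, φ A := by
  rw [← (Equiv.sigmaFiberEquiv (size : ColorTree s → ℕ)).tsum_eq φ, ENNReal.tsum_sigma']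
  refine tsum_congr fun q => ?_
  rw [← Finset.tsum_subtype (ofSize s q) φ]
  exact ((Equiv.subtypeEquivRight fun A => mem_ofSize (n := q) (t := A)).tsum_eq
    (fun A : {A : ColorTree s // A.size = q} => φ A)).symm

lemma tsum_tree_le_tsum_word (φ : List (Step s) → ℝ≥0∞) :
    ∑' A : ColorTree s, φ A.word ≤ ∑' W, φ W :=
  ENNReal.tsum_comp_le_tsum_of_injective word_injective φ

/-- The map (q, i) ↦ (i, q - 1 - i) is injective: i < q, so the subtraction does not truncate. -/
lemma tsum_splits_le (t : ℕ → ℕ → ℝ≥0∞) :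
    ∑' q, ∑ i ∈ Finset.range q, t i (q - 1 - i) ≤ ∑' i, ∑' j, t i j := by
  calc ∑' q, ∑ i ∈ Finset.range q, t i (q - 1 - i)
      = ∑' x : (Σ q : ℕ, Fin q), t x.2 (x.1 - 1 - x.2) := by
        rw [ENNReal.tsum_sigma']
        refine tsum_congr fun q => ?_
        rw [tsum_fintype, Finset.sum_range]
    _ ≤ ∑' x : ℕ × ℕ, t x.1 x.2 := by
        refine ENNReal.tsum_comp_le_tsum_of_injective
          (f := fun x : (Σ q : ℕ, Fin q) => ((x.2 : ℕ), x.1 - 1 - x.2)) ?_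
          (fun x : ℕ × ℕ => t x.1 x.2)
        rintro ⟨q, i⟩ ⟨q', i'⟩ h
        simp only [Prod.mk.injEq] at h
        have hi := i.2
        have hi' := i'.2
        obtain rfl : q = q' := by omega
        congr
        exact Fin.ext h.1
    _ = _ := ENNReal.tsum_prod

/-- A sum over all ways to cut words in two is at most a multiple of the sum over words. -/
lemma tsum_append_le {N : ℕ} {φ : List (Step s) → ℝ≥0∞} (hφ : ∀ w, N < w.length → φ w = 0) :
    ∑' P, ∑' Q, φ (P ++ Q) ≤ (N + 1) * ∑' W, φ W := by
  set Θ : ℕ × List (Step s) → ℝ≥0∞ := fun x => if x.1 ≤ N then φ x.2 else 0 with hΘ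
  calc ∑' P, ∑' Q, φ (P ++ Q)
      = ∑' x : List (Step s) × List (Step s), φ (x.1 ++ x.2) :=
        (ENNReal.tsum_prod (f := fun P Q => φ (P ++ Q))).symm
    _ ≤ ∑' x : List (Step s) × List (Step s), Θ (x.1.length, x.1 ++ x.2) := by
        refine ENNReal.tsum_le_tsum fun x => ?_
        by_cases h : x.1.length ≤ N
        · simp [hΘ, h]
        · rw [hφ _ (by rw [List.length_append]; omega)]
          exact zero_le
    _ ≤ ∑' x, Θ x := by
        refine ENNReal.tsum_comp_le_tsum_of_injective
          (f := fun x : List (Step s) × List (Step s) => (x.1.length, x.1 ++ x.2)) ?_ Θ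
        rintro ⟨P, Q⟩ ⟨P', Q'⟩ h
        simp only [Prod.mk.injEq] at h ⊢
        exact List.append_inj h.2 h.1
    _ = ∑' i : ℕ, if i ≤ N then ∑' W, φ W else 0 := by
        rw [ENNReal.tsum_prod']
        refine tsum_congr fun i => ?_
        by_cases h : i ≤ N <;> simp [hΘ, h]
    _ = (N + 1) * ∑' W, φ W := by
        rw [tsum_eq_sum (s := Finset.range (N + 1)) fun i hi => by
          rw [if_neg]; rw [Finset.mem_range] at hi; omega]
        rw [Finset.sum_congr rfl fun i hi => by
          rw [if_pos (Nat.lt_succ_iff.mp (Finset.mem_range.mp hi))]]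
        simp

lemma tsum_cons_le (φ : List (Step s) → ℝ≥0∞) :
    ∑' c, ∑' R, φ (c :: R) ≤ ∑' W, φ W := by
  rw [← ENNReal.tsum_prod (f := fun c R => φ (c :: R))]
  refine ENNReal.tsum_comp_le_tsum_of_injective
    (f := fun x : Step s × List (Step s) => x.1 :: x.2) ?_ φ
  rintro ⟨P, Q⟩ ⟨P', Q'⟩ h
  simpa using h

/-- The sum of `φ` over the words `P A c B Q` with Dyck words `A` and `B`. -/
noncomputable def pairSum (φ : List (Step s) → ℝ≥0∞)
    (x : List (Step s) × Step s × List (Step s)) : ℝ≥0∞ :=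
  ∑' A : ColorTree s, ∑' B : ColorTree s, φ (x.1 ++ (A.word ++ x.2.1 :: (B.word ++ x.2.2)))

/-- Allowing arbitrary words in place of A and B, a factorization P A c B Q is given by three cuts,
each with at most N + 1 positions. -/
lemma tsum_pairSum_le {N : ℕ} {φ : List (Step s) → ℝ≥0∞} (hφ : ∀ w, N < w.length → φ w = 0) :
    ∑' x, pairSum φ x ≤ (N + 1) ^ 3 * ∑' W, φ W := by
  calc ∑' x, pairSum φ x
      = ∑' P, ∑' c, ∑' Q, ∑' A : ColorTree s, ∑' B : ColorTree s,
          φ (P ++ (A.word ++ c :: (B.word ++ Q))) := by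
        rw [ENNReal.tsum_prod']
        refine tsum_congr fun P => ?_
        rw [ENNReal.tsum_prod']
        rfl
    _ = ∑' P, ∑' A : ColorTree s, ∑' c, ∑' B : ColorTree s, ∑' Q,
          φ (P ++ (A.word ++ c :: (B.word ++ Q))) := by
        refine tsum_congr fun P => ?_
        rw [ENNReal.tsum_comm]
        have : ∀ c : Step s, ∑' Q, ∑' A : ColorTree s, ∑' B : ColorTree s,
            φ (P ++ (A.word ++ c :: (B.word ++ Q))) = ∑' A : ColorTree s, ∑' B : ColorTree s,
            ∑' Q, φ (P ++ (A.word ++ c :: (B.word ++ Q))) := by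
          intro c
          rw [ENNReal.tsum_comm]
          exact tsum_congr fun A => ENNReal.tsum_comm
        rw [ENNReal.tsum_comm]
        simp_rw [this]
        exact ENNReal.tsum_comm
    _ ≤ ∑' P, ∑' V, ∑' c, ∑' X, ∑' Q, φ (P ++ (V ++ c :: (X ++ Q))) := by
        refine ENNReal.tsum_le_tsum fun P => ?_
        refine (tsum_tree_le_tsum_word (fun V => ∑' c, ∑' B : ColorTree s, ∑' Q,
          φ (P ++ (V ++ c :: (B.word ++ Q))))).trans ?_
        exact ENNReal.tsum_le_tsum fun V => ENNReal.tsum_le_tsum fun c =>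
          tsum_tree_le_tsum_word (fun X => ∑' Q, φ (P ++ (V ++ c :: (X ++ Q))))
    _ ≤ ∑' P, ∑' V, ∑' c, (N + 1) * ∑' R, φ (P ++ (V ++ c :: R)) :=
        ENNReal.tsum_le_tsum fun P => ENNReal.tsum_le_tsum fun V => ENNReal.tsum_le_tsum fun c =>
          tsum_append_le (φ := fun R => φ (P ++ (V ++ c :: R))) fun w hw => hφ _ (by
            simp only [List.length_append, List.length_cons]; omega)
    _ = (N + 1) * ∑' P, ∑' V, ∑' c, ∑' R, φ (P ++ (V ++ c :: R)) := by
        simp_rw [ENNReal.tsum_mul_left]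
    _ ≤ (N + 1) * ∑' P, ∑' V, ∑' R, φ (P ++ (V ++ R)) := by
        gcongr with P V
        exact tsum_cons_le fun R => φ (P ++ (V ++ R))
    _ ≤ (N + 1) * ∑' P, (N + 1) * ∑' R, φ (P ++ R) := by
        gcongr with P
        exact tsum_append_le (φ := fun R => φ (P ++ R)) fun w hw => hφ _ (by
            simp only [List.length_append]; omega)
    _ ≤ (N + 1) * ((N + 1) * ((N + 1) * ∑' R, φ R)) := by
        rw [ENNReal.tsum_mul_left]
        gcongr
        exact tsum_append_le hφ
    _ = _ := by ring

/-! ### The weight of words with a defect -/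

/-- The squared modulus, as an extended nonnegative real. -/
noncomputable def weight (z : ℂ) : ℝ≥0∞ := ENNReal.ofReal (‖z‖ ^ 2)

/-- The total energy of carrying peaks of any color through `W`. -/
noncomputable def carryWeight (ψ : List (Step s) → ℂ) (W : List (Step s)) : ℝ≥0∞ :=
  ∑ k, ENNReal.ofReal (carryEnergy ψ k W)

/-- The constant in the comparison of words `P A c Q` and `P c B Q`. -/
noncomputable def compConst (N : ℕ) : ℝ≥0∞ := 48 * (N + 1) ^ 5

/-- Sums `sum_left_le_sum_right` over all sizes q. Sizes above N contribute nothing on the left,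
which makes the constant uniform. -/
lemma tsum_tree_le_of_carry {N : ℕ} {f : ColorTree s → ColorTree s → ℂ}
    (hN : ∀ A, N < A.size → f A nil = 0)
    (e : Fin s → ColorTree s → ColorTree s → ℝ) (he0 : ∀ k A B, 0 ≤ e k A B)
    (he : ∀ k A B A' B', PeakInsertion k A A' → PeakInsertion k B B' →
      ‖f A' B - f A B'‖ ^ 2 ≤ N * e k A B) :
    ∑' A, weight (f A nil) ≤ compConst N * (∑' B, weight (f nil B) +
      N * ∑' A, ∑' B, ∑ k, ENNReal.ofReal (e k A B)) := by
  set t : ℕ → ℕ → ℝ≥0∞ := fun i j =>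
    ∑ A ∈ ofSize s i, ∑ B ∈ ofSize s j, ∑ k, ENNReal.ofReal (e k A B) with ht
  have hq : ∀ q, ∑ A ∈ ofSize s q, weight (f A nil) ≤ compConst N *
      (∑ B ∈ ofSize s q, weight (f nil B) + N * ∑ i ∈ Finset.range q, t i (q - 1 - i)) := by
    intro q
    rcases lt_or_ge N q with h | h
    · rw [Finset.sum_eq_zero]
      · exact zero_le
      · intro A hA
        rw [mem_ofSize] at hA
        simp [hN A (by omega), weight]
    have h1 := sum_left_le_sum_right f (fun k A B => N * e k A B)
      (fun k A B => mul_nonneg (by positivity) (he0 k A B)) he q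
    simp only [← Finset.mul_sum] at h1
    have h0 : 0 ≤ ∑ i ∈ Finset.range q, ∑ A ∈ ofSize s i, ∑ B ∈ ofSize s (q - 1 - i),
        ∑ k, e k A B := Finset.sum_nonneg fun i _ => Finset.sum_nonneg fun A _ =>
          Finset.sum_nonneg fun B _ => Finset.sum_nonneg fun k _ => he0 k A B
    have h2 : ∑ A ∈ ofSize s q, ‖f A nil‖ ^ 2 ≤ 48 * (N + 1) ^ 5 *
        (∑ B ∈ ofSize s q, ‖f nil B‖ ^ 2 + N * ∑ i ∈ Finset.range q, ∑ A ∈ ofSize s i,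
          ∑ B ∈ ofSize s (q - 1 - i), ∑ k, e k A B) := by
      refine h1.trans ?_
      gcongr
    have h3 := ENNReal.ofReal_le_ofReal h2
    rw [ENNReal.ofReal_sum_of_nonneg fun _ _ => by positivity,
      ENNReal.ofReal_mul (by positivity), ENNReal.ofReal_add (by positivity) (by positivity),
      ENNReal.ofReal_sum_of_nonneg (fun _ _ => by positivity),
      ENNReal.ofReal_mul (p := (N : ℝ)) (by positivity), ENNReal.ofReal_natCast] at h3
    refine h3.trans_eq ?_
    congr 1
    · rw [compConst, ENNReal.ofReal_mul (by norm_num), ENNReal.ofReal_pow (by positivity),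
        ENNReal.ofReal_add (by positivity) (by norm_num), ENNReal.ofReal_natCast]
      norm_num
    · congr 2
      rw [ENNReal.ofReal_sum_of_nonneg fun i _ => Finset.sum_nonneg fun A _ =>
          Finset.sum_nonneg fun B _ => Finset.sum_nonneg fun k _ => he0 k A B]
      refine Finset.sum_congr rfl fun i _ => ?_
      rw [ENNReal.ofReal_sum_of_nonneg fun A _ =>
          Finset.sum_nonneg fun B _ => Finset.sum_nonneg fun k _ => he0 k A B]
      refine Finset.sum_congr rfl fun A _ => ?_
      rw [ENNReal.ofReal_sum_of_nonneg fun B _ => Finset.sum_nonneg fun k _ => he0 k A B]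
      refine Finset.sum_congr rfl fun B _ => ?_
      rw [ENNReal.ofReal_sum_of_nonneg fun k _ => he0 k A B]
  have h4 : ∑' i, ∑' j, t i j = ∑' A, ∑' B, ∑ k, ENNReal.ofReal (e k A B) := by
    rw [tsum_tree_eq]
    refine tsum_congr fun i => ?_
    simp only [ht]
    rw [Summable.tsum_finsetSum fun _ _ => ENNReal.summable]
    exact Finset.sum_congr rfl fun A _ => (tsum_tree_eq _).symm
  rw [tsum_tree_eq, tsum_tree_eq (fun B => weight (f nil B))]
  calc _ ≤ ∑' q, compConst N *
      (∑ B ∈ ofSize s q, weight (f nil B) + N * ∑ i ∈ Finset.range q, t i (q - 1 - i)) :=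
        ENNReal.tsum_le_tsum hq
    _ = compConst N * (∑' q, ∑ B ∈ ofSize s q, weight (f nil B) +
          N * ∑' q, ∑ i ∈ Finset.range q, t i (q - 1 - i)) := by
        rw [ENNReal.tsum_mul_left, ENNReal.tsum_add, ENNReal.tsum_mul_left]
    _ ≤ _ := by
        rw [← h4]
        exact mul_le_mul_right (add_le_add_right (mul_le_mul_right (tsum_splits_le t) _) _) _

variable {N : ℕ} {ψ : List (Step s) → ℂ}

lemma tsum_before_le_after (hψ : ∀ w, w.length ≠ N → ψ w = 0)
    (x : List (Step s) × Step s × List (Step s)) :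
    ∑' A : ColorTree s, weight (ψ (x.1 ++ (A.word ++ x.2.1 :: x.2.2))) ≤
      compConst N * (∑' B : ColorTree s, weight (ψ (x.1 ++ x.2.1 :: (B.word ++ x.2.2))) +
        N * pairSum (carryWeight ψ) x) := by
  obtain ⟨P, c, Q⟩ := x
  refine tsum_tree_le_of_carry (f := fun A B => ψ (P ++ (A.word ++ c :: (B.word ++ Q))))
    (fun A hA => hψ _ ?_)
    (fun k A B => carryEnergy ψ k (P ++ (A.word ++ c :: (B.word ++ Q))))
    (fun k A B => carryEnergy_nonneg _ _ _)
    (fun k A B A' B' hA hB => norm_carry_sub_sq_le hψ P Q c k hA hB)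
  simp only [List.length_append, length_word]
  omega

/-- The reverse direction serves unmatched up steps: there the Dyck factor must move left, so that
the up step reaches the end of the chain. -/
lemma tsum_after_le_before (hψ : ∀ w, w.length ≠ N → ψ w = 0)
    (x : List (Step s) × Step s × List (Step s)) :
    ∑' B : ColorTree s, weight (ψ (x.1 ++ x.2.1 :: (B.word ++ x.2.2))) ≤
      compConst N * (∑' A : ColorTree s, weight (ψ (x.1 ++ (A.word ++ x.2.1 :: x.2.2))) +
        N * pairSum (carryWeight ψ) x) := by
  obtain ⟨P, c, Q⟩ := x
  rw [pairSum, ENNReal.tsum_comm]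
  refine tsum_tree_le_of_carry (f := fun B A => ψ (P ++ (A.word ++ c :: (B.word ++ Q))))
    (fun A hA => hψ _ ?_)
    (fun k B A => carryEnergy ψ k (P ++ (A.word ++ c :: (B.word ++ Q))))
    (fun k A B => carryEnergy_nonneg _ _ _)
    (fun k B A B' A' hB hA => by
      rw [norm_sub_rev]
      exact norm_carry_sub_sq_le hψ P Q c k hA hB)
  simp only [List.length_append, List.length_cons, length_word]
  omega

/-- The energy of the moves that exchange a peak with a neighbouring step. -/
noncomputable def moveWeight (ψ : List (Step s) → ℂ) : ℝ≥0∞ :=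
  ∑' (P : List (Step s)) (S : List (Step s)), ∑ c : Step s, ∑ k : Fin s,
    weight (ψ (P ++ c :: Step.u k :: Step.d k :: S) - ψ (P ++ Step.u k :: Step.d k :: c :: S))

/-- The prefix, the suffix and the exchanged step of a move determine both the word and the position
of the peak, so no move is counted twice. -/
lemma tsum_carryWeight_le (ψ : List (Step s) → ℂ) : ∑' W, carryWeight ψ W ≤ moveWeight ψ := by
  set F : List (Step s) × List (Step s) × Step s → ℝ≥0∞ := fun x => ∑ k : Fin s,
    weight (ψ (x.1 ++ x.2.2 :: Step.u k :: Step.d k :: x.2.1) -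
      ψ (x.1 ++ Step.u k :: Step.d k :: x.2.2 :: x.2.1)) with hF
  have h1 : ∀ W, carryWeight ψ W =
      ∑' i : Fin W.length, F (W.take i, W.drop (i + 1), W[i]) := by
    intro W
    rw [tsum_fintype, Finset.sum_comm]
    refine Finset.sum_congr rfl fun k _ => ?_
    rw [carryEnergy, ENNReal.ofReal_sum_of_nonneg fun _ _ => by positivity, Finset.sum_range]
    refine Finset.sum_congr rfl fun i _ => ?_
    rw [weight, norm_sub_rev]
    have h2 : W.drop i = W[i] :: W.drop (i + 1) := List.drop_eq_getElem_cons i.2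
    have h3 : W.take (i + 1) = W.take i ++ [W[i]] := by
      rw [List.take_add_one]
      simp
    rw [insertPeak, insertPeak, h3, h2, List.append_assoc]
    rfl
  have h4 : moveWeight ψ = ∑' x, F x := by
    rw [moveWeight, ENNReal.tsum_prod']
    refine tsum_congr fun P => ?_
    rw [ENNReal.tsum_prod']
    refine tsum_congr fun S => ?_
    rw [tsum_fintype]
  simp_rw [h1]
  rw [h4, ← ENNReal.tsum_sigma
    (fun (W : List (Step s)) (i : Fin W.length) => F (W.take i, W.drop (i + 1), W[i]))]
  refine ENNReal.tsum_comp_le_tsum_of_injective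
    (f := fun x : (Σ W : List (Step s), Fin W.length) =>
      (x.1.take x.2, x.1.drop (x.2 + 1), x.1[x.2])) ?_ F
  rintro ⟨W, i⟩ ⟨W', i'⟩ h
  simp only [Prod.mk.injEq] at h
  obtain ⟨h2, h3, h4⟩ := h
  have h5 : ∀ (W : List (Step s)) (i : Fin W.length),
      W = W.take i ++ W[i] :: W.drop (i + 1) := by
    intro W i
    have h2 : W.drop i = W[i] :: W.drop (i + 1) := List.drop_eq_getElem_cons i.2
    rw [← h2, List.take_append_drop]
  have h6 : W = W' := by
    rw [h5 W i, h5 W' i', h2, h3, h4]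
  subst h6
  congr
  have := congrArg List.length h2
  simp only [List.length_take] at this
  ext
  omega

lemma carryWeight_eq_zero (hψ : ∀ w, w.length ≠ N → ψ w = 0) (W : List (Step s))
    (hW : N < W.length) : carryWeight ψ W = 0 :=
  Finset.sum_eq_zero fun k _ => by rw [carryEnergy_eq_zero hψ k (by omega)]; simp

lemma tsum_pairSum_comp_le (hψ : ∀ w, w.length ≠ N → ψ w = 0) {ι : Type*}
    {m : ι → List (Step s) × Step s × List (Step s)} (hm : Function.Injective m) :
    ∑' i, pairSum (carryWeight ψ) (m i) ≤ (N + 1) ^ 3 * moveWeight ψ :=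
  (ENNReal.tsum_comp_le_tsum_of_injective hm _).trans
    ((tsum_pairSum_le (carryWeight_eq_zero hψ)).trans
      (mul_le_mul_right (tsum_carryWeight_le ψ) _))

/-- The weight of the words that are penalized by a boundary term or a cross term. -/
noncomputable def penaltyWeight (ψ : List (Step s) → ℂ) : ℝ≥0∞ :=
  (∑' S, ∑ a, weight (ψ (Step.d a :: S))) + (∑' P, ∑ a, weight (ψ (P ++ [Step.u a]))) +
    ∑' P, ∑' S, ∑ a, ∑ b, if a ≠ b then weight (ψ (P ++ Step.u a :: Step.d b :: S)) else 0

lemma weight_eq_zero (hψ : ∀ w, w.length ≠ N → ψ w = 0) {w : List (Step s)}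
    (hw : N < w.length) : weight (ψ w) = 0 := by
  simp [weight, hψ w (by omega)]

lemma tsum_comp_le_of_penalty {ι : Type*} (F G E : ι → ℝ≥0∞) {K n M p : ℝ≥0∞}
    (h : ∀ i, F i ≤ K * (G i + n * E i)) (hG : ∑' i, G i ≤ p) (hE : ∑' i, E i ≤ M) :
    ∑' i, F i ≤ K * (p + n * M) :=
  calc ∑' i, F i ≤ ∑' i, K * (G i + n * E i) := ENNReal.tsum_le_tsum h
    _ = K * (∑' i, G i + n * ∑' i, E i) := by
      rw [ENNReal.tsum_mul_left, ENNReal.tsum_add, ENNReal.tsum_mul_left]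
    _ ≤ _ := by gcongr

open Classical in
-- A word may have several defects; a section of `r` selects one, so no injectivity is needed.
lemma tsum_ite_range_le {ι κ : Type*} (r : ι → κ) (g : κ → ℝ≥0∞) :
    ∑' w, (if w ∈ Set.range r then g w else 0) ≤ ∑' i, g (r i) := by
  have h1 : (fun w => if w ∈ Set.range r then g w else 0) = (Set.range r).indicator g := by
    ext w
    simp [Set.indicator]
  rw [h1, ← tsum_subtype]
  calc ∑' w : Set.range r, g w = ∑' w : Set.range r, g (r (Set.rangeSplitting r w)) := by
        simp only [Set.apply_rangeSplitting]
    _ ≤ _ := ENNReal.tsum_comp_le_tsum_of_injective (Set.rangeSplitting_injective r)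
        (fun i => g (r i))

open Classical in
/-- The weight of the words that are not Dyck words is at most polynomially larger than the
energy. -/
theorem tsum_not_dyck_le (hψ : ∀ w, w.length ≠ N → ψ w = 0) :
    ∑' w, (if IsColoredDyck w then 0 else weight (ψ w)) ≤
      3 * compConst N * (N + 1) ^ 4 * (moveWeight ψ + penaltyWeight ψ) := by
  have hN : (N : ℝ≥0∞) ≤ N + 1 := le_self_add
  set I₁ := Fin s × List (Step s)
  set D : Set (List (Step s) × Fin s × Fin s × List (Step s)) := {x | x.2.1 ≠ x.2.2.1} with hD
  set I₂ := ↥D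
  set I₃ := List (Step s) × Fin s
  set m₁ : I₁ → List (Step s) × Step s × List (Step s) := fun i => ([], Step.d i.1, i.2) with hm₁
  -- The up step belongs to the prefix, so A is carried across the mismatched down step only and the
  -- two steps become adjacent.
  set m₂ : I₂ → List (Step s) × Step s × List (Step s) := fun i =>
    (i.1.1 ++ [Step.u i.1.2.1], Step.d i.1.2.2.1, i.1.2.2.2) with hm₂
  set m₃ : I₃ → List (Step s) × Step s × List (Step s) := fun i => (i.1, Step.u i.2, []) with hm₃
  set M := (N + 1 : ℝ≥0∞) ^ 3 * moveWeight ψ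
  have inj₁ : Function.Injective m₁ := by
    rintro ⟨a, Q⟩ ⟨a', Q'⟩ h
    simp only [hm₁, Step.d, Prod.mk.injEq, true_and] at h
    exact Prod.ext h.1 h.2
  have inj₂ : Function.Injective m₂ := by
    rintro ⟨⟨P, a, b, Q⟩, h⟩ ⟨⟨P', a', b', Q'⟩, h'⟩ heq
    simp only [hm₂, Prod.mk.injEq, Step.d, Step.u, true_and] at heq
    obtain ⟨h1, rfl, rfl⟩ := heq
    obtain ⟨rfl, h2⟩ := List.append_inj' h1 rfl
    simp at h2
    simp [h2]
  have inj₃ : Function.Injective m₃ := by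
    rintro ⟨P, a⟩ ⟨P', a'⟩ h
    simp only [hm₃, Step.u, Prod.mk.injEq, true_and, and_true] at h
    exact Prod.ext h.1 h.2
  have b₁ : ∑' i, ∑' A : ColorTree s,
      weight (ψ ((m₁ i).1 ++ (A.word ++ (m₁ i).2.1 :: (m₁ i).2.2))) ≤
      compConst N * ((N + 1) * (∑' S, ∑ a, weight (ψ (Step.d a :: S))) + N * M) := by
    refine tsum_comp_le_of_penalty _ _ _ (fun i => tsum_before_le_after hψ (m₁ i)) ?_
      (tsum_pairSum_comp_le hψ inj₁)
    rw [ENNReal.tsum_prod', Summable.tsum_finsetSum fun _ _ => ENNReal.summable, tsum_fintype,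
      Finset.mul_sum]
    refine Finset.sum_le_sum fun a _ => ?_
    rw [ENNReal.tsum_comm]
    refine (tsum_tree_le_tsum_word
      (fun B => ∑' Q, weight (ψ ([] ++ Step.d a :: (B ++ Q))))).trans ?_
    exact tsum_append_le (φ := fun S => weight (ψ (Step.d a :: S)))
      fun w hw => weight_eq_zero hψ (by rw [List.length_cons]; omega)
  have b₂ : ∑' i, ∑' A : ColorTree s,
      weight (ψ ((m₂ i).1 ++ (A.word ++ (m₂ i).2.1 :: (m₂ i).2.2))) ≤
      compConst N * ((N + 1) * (∑' P, ∑' S, ∑ a, ∑ b,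
        if a ≠ b then weight (ψ (P ++ Step.u a :: Step.d b :: S)) else 0) + N * M) := by
    refine tsum_comp_le_of_penalty _ _ _ (fun i => tsum_before_le_after hψ (m₂ i)) ?_
      (tsum_pairSum_comp_le hψ inj₂)
    refine (tsum_subtype D (fun x => ∑' B : ColorTree s,
      weight (ψ ((x.1 ++ [Step.u x.2.1]) ++ Step.d x.2.2.1 :: (B.word ++ x.2.2.2))))).trans_le ?_
    rw [ENNReal.tsum_prod', ← ENNReal.tsum_mul_left]
    refine ENNReal.tsum_le_tsum fun P => ?_
    rw [ENNReal.tsum_prod', Summable.tsum_finsetSum fun _ _ => ENNReal.summable, tsum_fintype,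
      Finset.mul_sum]
    refine Finset.sum_le_sum fun a _ => ?_
    rw [ENNReal.tsum_prod', Summable.tsum_finsetSum fun _ _ => ENNReal.summable, tsum_fintype,
      Finset.mul_sum]
    refine Finset.sum_le_sum fun b _ => ?_
    by_cases hab : a = b
    · simp [hab, hD]
    · simp only [hD, Set.indicator, Set.mem_ofPred_eq, ne_eq, hab, not_false_eq_true, if_true]
      rw [ENNReal.tsum_comm]
      refine (tsum_tree_le_tsum_word
        (fun B => ∑' Q, weight (ψ ((P ++ [Step.u a]) ++ Step.d b :: (B ++ Q))))).trans ?_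
      simp only [List.append_assoc, List.cons_append, List.nil_append]
      exact tsum_append_le (φ := fun S => weight (ψ (P ++ Step.u a :: Step.d b :: S)))
        fun w hw => weight_eq_zero hψ (by
          simp only [List.length_append, List.length_cons]; omega)
  have b₃ : ∑' i, ∑' B : ColorTree s,
      weight (ψ ((m₃ i).1 ++ (m₃ i).2.1 :: (B.word ++ (m₃ i).2.2))) ≤
      compConst N * ((N + 1) * (∑' P, ∑ a, weight (ψ (P ++ [Step.u a]))) + N * M) := by
    refine tsum_comp_le_of_penalty _ _ _ (fun i => tsum_after_le_before hψ (m₃ i)) ?_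
      (tsum_pairSum_comp_le hψ inj₃)
    rw [ENNReal.tsum_prod', ENNReal.tsum_comm, tsum_fintype,
      Summable.tsum_finsetSum fun _ _ => ENNReal.summable, Finset.mul_sum]
    refine Finset.sum_le_sum fun a _ => ?_
    refine (ENNReal.tsum_le_tsum fun P => tsum_tree_le_tsum_word
      (fun A => weight (ψ (P ++ (A ++ [Step.u a]))))).trans ?_
    simp only [← List.append_assoc]
    exact tsum_append_le (φ := fun S => weight (ψ (S ++ [Step.u a])))
      fun w hw => weight_eq_zero hψ (by rw [List.length_append]; omega)
  set r₁ : I₁ × ColorTree s → List (Step s) := fun x =>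
    (m₁ x.1).1 ++ (x.2.word ++ (m₁ x.1).2.1 :: (m₁ x.1).2.2) with hr₁
  set r₂ : I₂ × ColorTree s → List (Step s) := fun x =>
    (m₂ x.1).1 ++ (x.2.word ++ (m₂ x.1).2.1 :: (m₂ x.1).2.2) with hr₂
  set r₃ : I₃ × ColorTree s → List (Step s) := fun x =>
    (m₃ x.1).1 ++ (m₃ x.1).2.1 :: (x.2.word ++ (m₃ x.1).2.2) with hr₃
  have hcover : ∀ w, (if IsColoredDyck w then 0 else weight (ψ w)) ≤
      (if w ∈ Set.range r₁ then weight (ψ w) else 0) +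
      (if w ∈ Set.range r₂ then weight (ψ w) else 0) +
      (if w ∈ Set.range r₃ then weight (ψ w) else 0) := by
    intro w
    rcases dyck_or_defect w with ⟨A, rfl⟩ | ⟨A, a, Q, rfl⟩ | ⟨P, a, b, A, Q, hab, rfl⟩ |
      ⟨P, a, A, rfl⟩
    · simp [A.isColoredDyck_word]
    · have h : A.word ++ Step.d a :: Q ∈ Set.range r₁ := ⟨((a, Q), A), rfl⟩
      rw [if_pos h, add_assoc]
      refine le_trans ?_ le_self_add
      split_ifs <;> simp
    · have h : P ++ Step.u a :: (A.word ++ Step.d b :: Q) ∈ Set.range r₂ :=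
        ⟨(⟨(P, a, b, Q), hab⟩, A), by simp [hr₂, hm₂]⟩
      rw [if_pos h, add_comm (ite _ _ _), add_assoc]
      refine le_trans ?_ le_self_add
      split_ifs <;> simp
    · have h : P ++ Step.u a :: A.word ∈ Set.range r₃ := ⟨((P, a), A), by simp [hr₃, hm₃]⟩
      rw [if_pos h]
      refine le_trans ?_ le_add_self
      split_ifs <;> simp
  refine (ENNReal.tsum_le_tsum hcover).trans ?_
  rw [ENNReal.tsum_add, ENNReal.tsum_add]
  have c₁ := (tsum_ite_range_le r₁ fun w => weight (ψ w)).trans_eq ENNReal.tsum_prod'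
  have c₂ := (tsum_ite_range_le r₂ fun w => weight (ψ w)).trans_eq ENNReal.tsum_prod'
  have c₃ := (tsum_ite_range_le r₃ fun w => weight (ψ w)).trans_eq ENNReal.tsum_prod'
  refine (add_le_add (add_le_add (c₁.trans b₁) (c₂.trans b₂)) (c₃.trans b₃)).trans ?_
  rw [penaltyWeight]
  set p₁ := ∑' S, ∑ a, weight (ψ (Step.d a :: S))
  set p₂ := ∑' P, ∑' S, ∑ a, ∑ b, if a ≠ b then weight (ψ (P ++ Step.u a :: Step.d b :: S)) else 0
  set p₃ := ∑' P, ∑ a, weight (ψ (P ++ [Step.u a]))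
  have hpow : (N + 1 : ℝ≥0∞) ≤ (N + 1) ^ 4 := le_self_pow₀ le_add_self (by norm_num)
  have hNM : N * M ≤ (N + 1) ^ 4 * moveWeight ψ := by
    calc N * M ≤ (N + 1) * ((N + 1) ^ 3 * moveWeight ψ) := mul_le_mul_left hN _
      _ = _ := by ring
  have hp : ∀ p, p ≤ p₁ + p₃ + p₂ → compConst N * ((N + 1) * p + N * M) ≤
      compConst N * (N + 1) ^ 4 * (moveWeight ψ + (p₁ + p₃ + p₂)) := by
    intro p h
    calc compConst N * ((N + 1) * p + N * M)
        ≤ compConst N * ((N + 1) ^ 4 * (p₁ + p₃ + p₂) + (N + 1) ^ 4 * moveWeight ψ) := by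
          gcongr
      _ = _ := by ring
  calc _ ≤ compConst N * (N + 1) ^ 4 * (moveWeight ψ + (p₁ + p₃ + p₂)) +
        compConst N * (N + 1) ^ 4 * (moveWeight ψ + (p₁ + p₃ + p₂)) +
        compConst N * (N + 1) ^ 4 * (moveWeight ψ + (p₁ + p₃ + p₂)) :=
        add_le_add (add_le_add (hp _ (le_self_add.trans le_self_add)) (hp _ le_add_self))
          (hp _ (le_add_self.trans le_self_add))
    _ = _ := by ring

end Fredkin

namespace Fredkin

/-! ### Operators on a window of the chain -/

open scoped ENNReal Matrix

variable {s : ℕ}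

/-- The configuration with the parts `P`, `z` and `S`. -/
def glue {j k r : ℕ} (P : Config s j) (z : Config s k) (S : Config s r) : Config s (j + k + r) :=
  Fin.append (Fin.append P z) S

lemma ofFn_glue {j k r : ℕ} (P : Config s j) (z : Config s k) (S : Config s r) :
    List.ofFn (glue P z S) = List.ofFn P ++ (List.ofFn z ++ List.ofFn S) := by
  rw [glue, List.ofFn_fin_append, List.ofFn_fin_append, List.append_assoc]

/-- Cutting a configuration into three parts. -/
def glueEquiv (s j k r : ℕ) : (Config s j × Config s k) × Config s r ≃ Config s (j + k + r) :=
  ((Fin.appendEquiv j k).prodCongr (Equiv.refl _)).trans (Fin.appendEquiv (j + k) r)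

lemma exists_glue {j k r : ℕ} (x : Config s (j + k + r)) :
    ∃ (P : Config s j) (z : Config s k) (S : Config s r), x = glue P z S := by
  obtain ⟨⟨⟨P, z⟩, S⟩, rfl⟩ := (glueEquiv s j k r).surjective x
  exact ⟨P, z, S, rfl⟩

lemma sum_config {M : Type*} [AddCommMonoid M] {j k r : ℕ} (φ : Config s (j + k + r) → M) :
    ∑ x, φ x = ∑ P : Config s j, ∑ S : Config s r, ∑ z : Config s k, φ (glue P z S) := by
  rw [← (glueEquiv s j k r).sum_comp, Fintype.sum_prod_type, Fintype.sum_prod_type]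
  exact Finset.sum_congr rfl fun P _ => Finset.sum_comm

/-- With the chain length written as j + k + r, the operator is visibly the identity on the outer
parts tensored with `M`. -/
lemma actAt_glue {j k r : ℕ} (M : Matrix (Config s k) (Config s k) ℂ) (P P' : Config s j)
    (z z' : Config s k) (S S' : Config s r) :
    actAt (j + k + r) j M (glue P z S) (glue P' z' S') =
      if P = P' ∧ S = S' then M z z' else 0 := by
  have hmid : ∀ (P : Config s j) (z : Config s k) (S : Config s r) (a : Fin k)
      (h : j + a.val < j + k + r), glue P z S ⟨j + a.val, h⟩ = z a := by
    intro P z S a h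
    have : (⟨j + a.val, h⟩ : Fin (j + k + r)) = Fin.castAdd r (Fin.natAdd j a) := rfl
    rw [this, glue, Fin.append_left, Fin.append_right]
  have hcond : (∀ i : Fin (j + k + r), (i.val < j ∨ j + k ≤ i.val) →
      glue P z S i = glue P' z' S' i) ↔ P = P' ∧ S = S' := by
    constructor
    · intro h
      constructor
      · ext1 i
        have := h (Fin.castAdd r (Fin.castAdd k i)) (Or.inl (by simp))
        simpa [glue] using this
      · ext1 i
        have := h (Fin.natAdd (j + k) i) (Or.inr (by simp))
        simpa [glue] using this
    · rintro ⟨rfl, rfl⟩ i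
      refine Fin.addCases (fun i => ?_) (fun i _ => by simp [glue]) i
      refine Fin.addCases (fun i _ => by simp [glue]) (fun i h => ?_) i
      simp only [Fin.val_castAdd, Fin.val_natAdd] at h
      omega
  rw [actAt, dif_pos (Nat.le_add_right _ _)]
  simp only [hcond, hmid]

lemma actAt_of_lt {N j k : ℕ} (M : Matrix (Config s k) (Config s k) ℂ) (h : N < j + k) :
    actAt N j M = 0 := by
  ext x y
  rw [actAt, dif_neg (by omega)]
  rfl

lemma isHermitian_ketBra {k : ℕ} (w : Config s k → ℂ) : (ketBra w).IsHermitian := by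
  rw [ketBra, Matrix.IsHermitian, Matrix.conjTranspose_vecMulVec, star_star]

lemma isSelfAdjoint_actAt {k : ℕ} (N j : ℕ) (w : Config s k → ℂ) :
    IsSelfAdjoint (actAt N j (ketBra w)) := by
  ext x y
  rw [Matrix.star_apply, actAt, actAt]
  by_cases h : j + k ≤ N
  · rw [dif_pos h, dif_pos h]
    have : (∀ i : Fin N, (i.val < j ∨ j + k ≤ i.val) → y i = x i) ↔
        ∀ i : Fin N, (i.val < j ∨ j + k ≤ i.val) → x i = y i :=
      forall₂_congr fun i _ => eq_comm
    simp only [this]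
    split_ifs
    · exact (isHermitian_ketBra w).apply _ _
    · simp
  · rw [dif_neg h, dif_neg h, star_zero]

lemma isSelfAdjoint_fredkinMatrix (s n : ℕ) : IsSelfAdjoint (fredkinMatrix s n) := by
  refine ((isSelfAdjoint_sum _ fun j _ => ?_).add (isSelfAdjoint_sum _ fun j _ => ?_)).add
    (isSelfAdjoint_sum _ fun a _ => ?_)
  · exact isSelfAdjoint_sum _ fun a _ => isSelfAdjoint_sum _ fun b _ =>
      ((isSelfAdjoint_actAt _ _ _).add (isSelfAdjoint_actAt _ _ _)).add (isSelfAdjoint_actAt _ _ _)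
  · refine isSelfAdjoint_sum _ fun a _ => isSelfAdjoint_sum _ fun b _ => ?_
    split_ifs
    · exact isSelfAdjoint_actAt _ _ _
    · exact IsSelfAdjoint.zero _
  · exact (isSelfAdjoint_actAt _ _ _).add (isSelfAdjoint_actAt _ _ _)

/-! ### Invariance of the set of colored Dyck words -/

/-- The matrix has no entries between colored Dyck words and other words. -/
def PreservesDyck {N : ℕ} (M : Matrix (Config s N) (Config s N) ℂ) : Prop :=
  ∀ x y, M x y ≠ 0 → (IsColoredDyck (List.ofFn x) ↔ IsColoredDyck (List.ofFn y))

lemma PreservesDyck.zero {N : ℕ} :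
    PreservesDyck (0 : Matrix (Config s N) (Config s N) ℂ) := fun _ _ h => (h rfl).elim

lemma PreservesDyck.add {N : ℕ} {M M' : Matrix (Config s N) (Config s N) ℂ}
    (h : PreservesDyck M) (h' : PreservesDyck M') : PreservesDyck (M + M') := by
  intro x y hxy
  by_cases hM : M x y = 0
  · refine h' x y fun hM' => hxy ?_
    rw [Matrix.add_apply, hM, hM', add_zero]
  · exact h x y hM

lemma PreservesDyck.sum {N : ℕ} {ι : Type*} {S : Finset ι}
    {M : ι → Matrix (Config s N) (Config s N) ℂ} (h : ∀ i ∈ S, PreservesDyck (M i)) :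
    PreservesDyck (∑ i ∈ S, M i) :=
  Finset.sum_induction M PreservesDyck (fun _ _ => .add) .zero h

lemma preservesDyck_actAt {k : ℕ} (N j : ℕ) {w : Config s k → ℂ}
    (hw : ∀ z z', w z ≠ 0 → w z' ≠ 0 → ∀ P S : List (Step s),
      IsColoredDyck (P ++ (List.ofFn z ++ S)) ↔ IsColoredDyck (P ++ (List.ofFn z' ++ S))) :
    PreservesDyck (actAt N j (ketBra w)) := by
  rcases lt_or_ge N (j + k) with h | h
  · rw [actAt_of_lt _ h]
    exact .zero
  · obtain ⟨r, rfl⟩ := Nat.exists_eq_add_of_le h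
    intro x y hxy
    obtain ⟨P, z, S, rfl⟩ := exists_glue x
    obtain ⟨P', z', S', rfl⟩ := exists_glue y
    rw [actAt_glue] at hxy
    split_ifs at hxy with hPS
    · obtain ⟨rfl, rfl⟩ := hPS
      rw [ketBra, Matrix.vecMulVec_apply, Pi.star_apply] at hxy
      rw [ofFn_glue, ofFn_glue]
      exact hw z z' (left_ne_zero_of_mul hxy)
        (fun h => right_ne_zero_of_mul hxy (by rw [h, star_zero])) _ _
    · exact (hxy rfl).elim

lemma ket_ne_zero {k : ℕ} {x z : Config s k} (h : ket x z ≠ 0) : z = x := by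
  by_contra hne
  exact h (Pi.single_eq_of_ne hne _)

lemma preservesDyck_actAt_ket {k : ℕ} (N j : ℕ) (x : Config s k) :
    PreservesDyck (actAt N j (ketBra (ket x))) :=
  preservesDyck_actAt N j fun z z' hz hz' P S => by rw [ket_ne_zero hz, ket_ne_zero hz']

lemma preservesDyck_actAt_sub {k : ℕ} (N j : ℕ) (c : ℂ) (x y : Config s k)
    (hxy : ∀ P S : List (Step s),
      IsColoredDyck (P ++ (List.ofFn x ++ S)) ↔ IsColoredDyck (P ++ (List.ofFn y ++ S))) :
    PreservesDyck (actAt N j (ketBra (c • (ket x - ket y)))) := by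
  have h : ∀ z, (c • (ket x - ket y)) z ≠ 0 → z = x ∨ z = y := by
    intro z hz
    by_contra! hne
    refine hz ?_
    simp [ket, Pi.single_eq_of_ne hne.1, Pi.single_eq_of_ne hne.2]
  refine preservesDyck_actAt N j fun z z' hz hz' P S => ?_
  rcases h z hz with rfl | rfl <;> rcases h z' hz' with rfl | rfl
  · rfl
  · exact hxy P S
  · exact (hxy P S).symm
  · rfl

lemma isColoredDyck_cons_peak_iff (P S : List (Step s)) (c : Step s) (k : Fin s) :
    IsColoredDyck (P ++ c :: Step.u k :: Step.d k :: S) ↔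
      IsColoredDyck (P ++ Step.u k :: Step.d k :: c :: S) := by
  have h := isColoredDyck_peak_iff (P ++ [c]) S k
  simp only [List.append_assoc, List.cons_append, List.nil_append] at h
  rw [h, isColoredDyck_peak_iff]

lemma preservesDyck_fredkinMatrix (s n : ℕ) : PreservesDyck (fredkinMatrix s n) := by
  refine ((PreservesDyck.sum fun j _ => ?_).add (PreservesDyck.sum fun j _ => ?_)).add
    (PreservesDyck.sum fun a _ => ?_)
  · refine PreservesDyck.sum fun a _ => PreservesDyck.sum fun b _ => .add (.add ?_ ?_) ?_
    · exact preservesDyck_actAt_sub _ _ _ _ _ fun P S => by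
        simpa using isColoredDyck_cons_peak_iff P S (Step.u a) b
    · exact preservesDyck_actAt_sub _ _ _ _ _ fun P S => by
        simpa using isColoredDyck_cons_peak_iff P S (Step.d a) b
    · exact preservesDyck_actAt_sub _ _ _ _ _ fun P S => by
        simpa using (isColoredDyck_peak_iff P S a).trans (isColoredDyck_peak_iff P S b).symm
  · refine PreservesDyck.sum fun a _ => PreservesDyck.sum fun b _ => ?_
    split_ifs
    · exact preservesDyck_actAt_ket _ _ _
    · exact .zero
  · exact (preservesDyck_actAt_ket _ _ _).add (preservesDyck_actAt_ket _ _ _)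

lemma mem_unbalancedSubspace_iff {n : ℕ} (v : ChainSpace s (2 * n)) :
    v ∈ unbalancedSubspace s n ↔ ∀ x, IsColoredDyck (List.ofFn x) → v x = 0 := by
  constructor
  · intro hv x hx
    induction hv using Submodule.span_induction with
    | mem v h =>
      obtain ⟨y, hy, rfl⟩ := h
      have hxy : x ≠ y := fun h => hy (h ▸ hx)
      simp [hxy]
    | zero => rfl
    | add v w _ _ hv hw => rw [PiLp.add_apply, hv, hw, add_zero]
    | smul a v _ hv => rw [PiLp.smul_apply, hv, smul_zero]
  · intro hv
    have h : v = ∑ x, v x • EuclideanSpace.single x (1 : ℂ) := by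
      ext x
      simp [Pi.single_apply]
    rw [h]
    refine Submodule.sum_mem _ fun x _ => ?_
    by_cases hx : IsColoredDyck (List.ofFn x)
    · rw [hv x hx, zero_smul]
      exact Submodule.zero_mem _
    · exact Submodule.smul_mem _ _ (Submodule.subset_span ⟨x, hx, rfl⟩)

lemma fredkinH_mem_unbalancedSubspace {n : ℕ} (v : ChainSpace s (2 * n))
    (hv : v ∈ unbalancedSubspace s n) : fredkinH s n v ∈ unbalancedSubspace s n := by
  rw [mem_unbalancedSubspace_iff] at hv ⊢
  intro x hx
  change (fredkinMatrix s n *ᵥ v.ofLp) x = 0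
  refine Finset.sum_eq_zero fun y _ => ?_
  by_cases hxy : fredkinMatrix s n x y = 0
  · simp [hxy]
  · rw [hv y ((preservesDyck_fredkinMatrix s n x y hxy).mp hx), mul_zero]

/-! ### The quadratic form of the Hamiltonian -/

/-- A vector as a function of words, extended by zero. -/
noncomputable def onWords {N : ℕ} (v : Config s N → ℂ) (w : List (Step s)) : ℂ :=
  if h : w.length = N then v (fun i => w.get (i.cast h.symm)) else 0

lemma onWords_ofFn {N : ℕ} (v : Config s N → ℂ) (x : Config s N) :
    onWords v (List.ofFn x) = v x := by
  rw [onWords, dif_pos (List.length_ofFn)]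
  congr
  ext1 i
  simp

lemma onWords_of_length_ne {N : ℕ} (v : Config s N → ℂ) (w : List (Step s)) (h : w.length ≠ N) :
    onWords v w = 0 := dif_neg h

lemma sum_config_eq_tsum {j : ℕ} (φ : List (Step s) → ℝ≥0∞) :
    ∑ P : Config s j, φ (List.ofFn P) = ∑' P, if P.length = j then φ P else 0 := by
  rw [← List.equivSigmaTuple.symm.tsum_eq, ENNReal.tsum_sigma', tsum_eq_single j]
  · rw [tsum_fintype]
    refine Finset.sum_congr rfl fun P _ => ?_
    change _ = if (List.ofFn P).length = j then φ (List.ofFn P) else 0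
    rw [if_pos List.length_ofFn]
  · intro i hi
    rw [ENNReal.tsum_eq_zero]
    intro P
    change (if (List.ofFn P).length = j then φ (List.ofFn P) else 0) = 0
    rw [if_neg (by rwa [List.length_ofFn])]

/-- The real part of the quadratic form of a matrix at `v`. -/
noncomputable def form {N : ℕ} (v : Config s N → ℂ) :
    Matrix (Config s N) (Config s N) ℂ →+ ℝ where
  toFun M := (star v ⬝ᵥ (M *ᵥ v)).re
  map_zero' := by simp
  map_add' M M' := by simp [Matrix.add_mulVec]

lemma form_actAt_glue {j k r : ℕ} (v : Config s (j + k + r) → ℂ) (w : Config s k → ℂ) :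
    form v (actAt (j + k + r) j (ketBra w)) =
      ∑ P : Config s j, ∑ S : Config s r, ‖∑ z, star (w z) * v (glue P z S)‖ ^ 2 := by
  have h1 : ∀ (P : Config s j) (S : Config s r) (z : Config s k),
      (actAt (j + k + r) j (ketBra w) *ᵥ v) (glue P z S) =
        w z * ∑ z', star (w z') * v (glue P z' S) := by
    intro P S z
    rw [Matrix.mulVec, dotProduct, sum_config]
    simp only [actAt_glue]
    rw [Finset.sum_eq_single P, Finset.sum_eq_single S, Finset.mul_sum]
    · refine Finset.sum_congr rfl fun z' _ => ?_
      simp [ketBra, Matrix.vecMulVec_apply, mul_assoc]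
    · intro S' _ h
      exact Finset.sum_eq_zero fun z' _ => by rw [if_neg fun h' => h h'.2.symm, zero_mul]
    · simp
    · intro P' _ h
      exact Finset.sum_eq_zero fun S' _ => Finset.sum_eq_zero fun z' _ => by
        rw [if_neg fun h' => h h'.1.symm, zero_mul]
    · simp
  change (∑ x, star v x * (actAt (j + k + r) j (ketBra w) *ᵥ v) x).re = _
  rw [sum_config]
  simp only [h1, Complex.re_sum]
  refine Finset.sum_congr rfl fun P _ => Finset.sum_congr rfl fun S _ => ?_
  rw [← Complex.re_sum]
  have h2 : ∑ z, star v (glue P z S) * (w z * ∑ z', star (w z') * v (glue P z' S)) =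
      star (∑ z, star (w z) * v (glue P z S)) * ∑ z', star (w z') * v (glue P z' S) := by
    rw [star_sum, Finset.sum_mul]
    refine Finset.sum_congr rfl fun z _ => ?_
    rw [star_mul', star_star, Pi.star_apply]
    ring
  rw [h2, Complex.star_def, Complex.conj_mul', ← Complex.ofReal_pow, Complex.ofReal_re]

lemma form_actAt_nonneg {N k : ℕ} (v : Config s N → ℂ) (j : ℕ) (w : Config s k → ℂ) :
    0 ≤ form v (actAt N j (ketBra w)) := by
  rcases lt_or_ge N (j + k) with h | h
  · rw [actAt_of_lt _ h, map_zero]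
  · obtain ⟨r, rfl⟩ := Nat.exists_eq_add_of_le h
    rw [form_actAt_glue]
    positivity

lemma ofReal_form_actAt {N k : ℕ} (v : Config s N → ℂ) (j : ℕ) (w : Config s k → ℂ) :
    ENNReal.ofReal (form v (actAt N j (ketBra w))) = ∑' P : List (Step s), if P.length = j then
      ∑' S, weight (∑ z, star (w z) * onWords v (P ++ (List.ofFn z ++ S))) else 0 := by
  rcases lt_or_ge N (j + k) with h | h
  · rw [actAt_of_lt _ h, map_zero, ENNReal.ofReal_zero]
    symm
    rw [ENNReal.tsum_eq_zero]
    intro P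
    split_ifs with hP
    · rw [ENNReal.tsum_eq_zero]
      intro S
      rw [Finset.sum_eq_zero]
      · simp [weight]
      · intro z _
        rw [onWords_of_length_ne _ _ (by simp; omega), mul_zero]
    · rfl
  · obtain ⟨r, rfl⟩ := Nat.exists_eq_add_of_le h
    rw [form_actAt_glue, ENNReal.ofReal_sum_of_nonneg fun _ _ => by positivity,
      ← sum_config_eq_tsum
        (fun P => ∑' S, weight (∑ z, star (w z) * onWords v (P ++ (List.ofFn z ++ S))))]
    refine Finset.sum_congr rfl fun P _ => ?_
    rw [ENNReal.ofReal_sum_of_nonneg fun _ _ => by positivity]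
    have h1 : ∀ S, weight (∑ z, star (w z) * onWords v (List.ofFn P ++ (List.ofFn z ++ S))) =
        if S.length = r then
          weight (∑ z, star (w z) * onWords v (List.ofFn P ++ (List.ofFn z ++ S))) else 0 := by
      intro S
      split_ifs with hS
      · rfl
      · rw [Finset.sum_eq_zero]
        · simp [weight]
        · intro z _
          rw [onWords_of_length_ne _ _ (by simp; omega), mul_zero]
    rw [tsum_congr h1, ← sum_config_eq_tsum
      (fun S => weight (∑ z, star (w z) * onWords v (List.ofFn P ++ (List.ofFn z ++ S))))]
    refine Finset.sum_congr rfl fun S _ => ?_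
    simp only [← ofFn_glue, onWords_ofFn]
    rfl

/-- The site j becomes the length of the prefix P. By `hJ`, a prefix of length at least J leaves no
room for the window, so the sum over P is unrestricted. -/
lemma sum_ofReal_form_actAt {N k : ℕ} (v : Config s N → ℂ) (J : ℕ) (hJ : N < J + k)
    (w : Config s k → ℂ) :
    ∑ j ∈ Finset.range J, ENNReal.ofReal (form v (actAt N j (ketBra w))) =
      ∑' (P : List (Step s)) (S : List (Step s)),
        weight (∑ z, star (w z) * onWords v (P ++ (List.ofFn z ++ S))) := by
  simp only [ofReal_form_actAt]
  rw [← Summable.tsum_finsetSum fun _ _ => ENNReal.summable]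
  refine tsum_congr fun P => ?_
  rw [Finset.sum_ite_eq]
  split_ifs with h
  · rfl
  · symm
    rw [ENNReal.tsum_eq_zero]
    intro S
    rw [Finset.sum_eq_zero]
    · simp [weight]
    · intro z _
      rw [Finset.mem_range] at h
      rw [onWords_of_length_ne _ _ (by simp; omega), mul_zero]

lemma sum_star_ket {k : ℕ} (x : Config s k) (F : Config s k → ℂ) :
    ∑ z, star (ket x z) * F z = F x := by
  rw [Finset.sum_eq_single x]
  · simp [ket]
  · intro z _ hz
    simp [ket, Pi.single_eq_of_ne hz]
  · simp

lemma weight_sum_star_sub {k : ℕ} (x y : Config s k) (F : Config s k → ℂ) :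
    weight (∑ z, star (((1 / (Real.sqrt 2 : ℂ)) • (ket x - ket y)) z) * F z) =
      2⁻¹ * weight (F x - F y) := by
  have h : ∑ z, star (((1 / (Real.sqrt 2 : ℂ)) • (ket x - ket y)) z) * F z =
      (1 / (Real.sqrt 2 : ℂ)) * (F x - F y) := by
    rw [← sum_star_ket x F, ← sum_star_ket y F, ← Finset.sum_sub_distrib, Finset.mul_sum]
    refine Finset.sum_congr rfl fun z _ => ?_
    simp
    ring
  rw [h, weight, weight, norm_mul, mul_pow, ENNReal.ofReal_mul (by positivity)]
  congr 1
  rw [norm_div, norm_one, Complex.norm_real, Real.norm_eq_abs, div_pow, sq_abs,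
    Real.sq_sqrt (by norm_num), one_pow, one_div, ENNReal.ofReal_inv_of_pos (by norm_num)]
  simp

/-- The vectors `vecU` and `vecD` exchange a peak with an up step and a down step respectively; the
half is the square of their normalization. The `vecPhi` terms are dropped by positivity. -/
lemma half_moveWeight_le {n : ℕ} (hn : 1 ≤ n) (v : Config s (2 * n) → ℂ) :
    2⁻¹ * moveWeight (onWords v) ≤
      ENNReal.ofReal (form v (∑ j ∈ Finset.range (2 * n - 2), moveTerm s (2 * n) j)) := by
  have h0 : ∀ {k : ℕ} (j : ℕ) (w : Config s k → ℂ), 0 ≤ form v (actAt (2 * n) j (ketBra w)) :=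
    fun j w => form_actAt_nonneg v j w
  have h1 : ∑ j ∈ Finset.range (2 * n - 2), ∑ a : Fin s, ∑ b : Fin s,
      (form v (actAt (2 * n) j (ketBra (vecU a b))) +
        form v (actAt (2 * n) j (ketBra (vecD a b)))) ≤
      form v (∑ j ∈ Finset.range (2 * n - 2), moveTerm s (2 * n) j) := by
    simp only [map_sum, moveTerm, map_add]
    exact Finset.sum_le_sum fun j _ => Finset.sum_le_sum fun a _ => Finset.sum_le_sum fun b _ =>
      le_add_of_nonneg_right (h0 _ _)
  refine le_trans (le_of_eq ?_) (ENNReal.ofReal_le_ofReal h1)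
  have h2 : ENNReal.ofReal (∑ j ∈ Finset.range (2 * n - 2), ∑ a : Fin s, ∑ b : Fin s,
      (form v (actAt (2 * n) j (ketBra (vecU a b))) +
        form v (actAt (2 * n) j (ketBra (vecD a b))))) =
      ∑ a : Fin s, ∑ b : Fin s, (∑ j ∈ Finset.range (2 * n - 2),
        ENNReal.ofReal (form v (actAt (2 * n) j (ketBra (vecU a b)))) +
        ∑ j ∈ Finset.range (2 * n - 2),
        ENNReal.ofReal (form v (actAt (2 * n) j (ketBra (vecD a b))))) := by
    rw [Finset.sum_comm, ENNReal.ofReal_sum_of_nonneg fun a _ => Finset.sum_nonneg fun j _ =>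
      Finset.sum_nonneg fun b _ => add_nonneg (h0 _ _) (h0 _ _)]
    refine Finset.sum_congr rfl fun a _ => ?_
    rw [Finset.sum_comm, ENNReal.ofReal_sum_of_nonneg fun a _ => Finset.sum_nonneg fun j _ =>
      add_nonneg (h0 _ _) (h0 _ _)]
    refine Finset.sum_congr rfl fun b _ => ?_
    rw [ENNReal.ofReal_sum_of_nonneg fun j _ => add_nonneg (h0 _ _) (h0 _ _),
      ← Finset.sum_add_distrib]
    exact Finset.sum_congr rfl fun j _ => ENNReal.ofReal_add (h0 _ _) (h0 _ _)
  rw [h2]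
  simp only [sum_ofReal_form_actAt v (2 * n - 2) (k := 3) (by omega), vecU, vecD,
    weight_sum_star_sub]
  simp only [← ENNReal.tsum_add, moveWeight, ← ENNReal.tsum_mul_left,
    ← Summable.tsum_finsetSum (fun _ _ => ENNReal.summable)]
  refine tsum_congr fun P => tsum_congr fun S => ?_
  rw [Fintype.sum_prod_type, Fintype.sum_bool, ← Finset.sum_add_distrib, Finset.mul_sum]
  refine Finset.sum_congr rfl fun a _ => ?_
  rw [← Finset.sum_add_distrib, Finset.mul_sum]
  refine Finset.sum_congr rfl fun b _ => ?_
  rw [mul_add]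
  simp [Step.u, Step.d]

lemma crossWeight_eq {n : ℕ} (hn : 1 ≤ n) (v : Config s (2 * n) → ℂ) :
    ENNReal.ofReal (form v (∑ j ∈ Finset.range (2 * n - 1), crossTerm s (2 * n) j)) =
      ∑' P, ∑' S, ∑ a, ∑ b,
        if a ≠ b then weight (onWords v (P ++ Step.u a :: Step.d b :: S)) else 0 := by
  have h0 : ∀ (j : ℕ) (a b : Fin s), 0 ≤ if a ≠ b then
      form v (actAt (2 * n) j (ketBra (ket ![Step.u a, Step.d b]))) else 0 := by
    intro j a b
    split_ifs
    · exact form_actAt_nonneg _ _ _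
    · exact le_rfl
  have h1 : form v (∑ j ∈ Finset.range (2 * n - 1), crossTerm s (2 * n) j) =
      ∑ a, ∑ b, ∑ j ∈ Finset.range (2 * n - 1), if a ≠ b then
        form v (actAt (2 * n) j (ketBra (ket ![Step.u a, Step.d b]))) else 0 := by
    simp only [map_sum, crossTerm, apply_ite (form v), map_zero]
    rw [Finset.sum_comm]
    exact Finset.sum_congr rfl fun a _ => Finset.sum_comm
  rw [h1, ENNReal.ofReal_sum_of_nonneg fun a _ => Finset.sum_nonneg fun b _ =>
    Finset.sum_nonneg fun j _ => h0 j a b]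
  simp only [Summable.tsum_finsetSum (fun _ _ => ENNReal.summable)]
  refine Finset.sum_congr rfl fun a _ => ?_
  rw [ENNReal.ofReal_sum_of_nonneg fun b _ => Finset.sum_nonneg fun j _ => h0 j a b]
  refine Finset.sum_congr rfl fun b _ => ?_
  by_cases hab : a = b
  · simp [hab]
  · simp only [ne_eq, hab, not_false_eq_true, if_true]
    rw [ENNReal.ofReal_sum_of_nonneg fun j _ => form_actAt_nonneg _ _ _,
      sum_ofReal_form_actAt v (2 * n - 1) (k := 2) (by omega)]
    simp only [sum_star_ket ![Step.u a, Step.d b]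
      (fun z => onWords v (_ ++ (List.ofFn z ++ _)))]
    simp

lemma boundaryWeight_eq {n : ℕ} (hn : 1 ≤ n) (v : Config s (2 * n) → ℂ) :
    ENNReal.ofReal (form v (boundaryTerm s (2 * n))) =
      (∑' S, ∑ a, weight (onWords v (Step.d a :: S))) +
        ∑' P, ∑ a, weight (onWords v (P ++ [Step.u a])) := by
  simp only [Summable.tsum_finsetSum (fun _ _ => ENNReal.summable)]
  rw [boundaryTerm, map_sum, ENNReal.ofReal_sum_of_nonneg fun a _ => by
    rw [map_add]
    exact add_nonneg (form_actAt_nonneg _ _ _) (form_actAt_nonneg _ _ _),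
    ← Finset.sum_add_distrib]
  refine Finset.sum_congr rfl fun a _ => ?_
  rw [map_add, ENNReal.ofReal_add (form_actAt_nonneg _ _ _) (form_actAt_nonneg _ _ _),
    ofReal_form_actAt, ofReal_form_actAt]
  congr 1
  · rw [tsum_eq_single []]
    · rw [if_pos List.length_nil]
      refine tsum_congr fun S => ?_
      rw [sum_star_ket ![Step.d a] (fun z => onWords v ([] ++ (List.ofFn z ++ S)))]
      simp
    · intro P hP
      rw [if_neg]
      rwa [List.length_eq_zero_iff]
  · refine tsum_congr fun P => ?_
    have h : ∀ S, weight (∑ z, star (ket ![Step.u a] z) * onWords v (P ++ (List.ofFn z ++ S))) =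
        weight (onWords v (P ++ Step.u a :: S)) := by
      intro S
      rw [sum_star_ket ![Step.u a] (fun z => onWords v (P ++ (List.ofFn z ++ S)))]
      simp
    simp only [h]
    split_ifs with hP
    · rw [tsum_eq_single []]
      intro S hS
      have := List.length_pos_iff.mpr hS
      rw [onWords_of_length_ne]
      · simp [weight]
      · simp only [List.length_append, List.length_cons]
        omega
    · rw [onWords_of_length_ne]
      · simp [weight]
      · simp only [List.length_append, List.length_cons, List.length_nil]
        omega

lemma form_nonneg_of_sum_actAt {n : ℕ} (v : Config s (2 * n) → ℂ) :
    0 ≤ form v (∑ j ∈ Finset.range (2 * n - 2), moveTerm s (2 * n) j) ∧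
    0 ≤ form v (∑ j ∈ Finset.range (2 * n - 1), crossTerm s (2 * n) j) ∧
    0 ≤ form v (boundaryTerm s (2 * n)) := by
  refine ⟨?_, ?_, ?_⟩
  · simp only [map_sum, moveTerm, map_add]
    exact Finset.sum_nonneg fun j _ => Finset.sum_nonneg fun a _ => Finset.sum_nonneg fun b _ =>
      add_nonneg (add_nonneg (form_actAt_nonneg _ _ _) (form_actAt_nonneg _ _ _))
        (form_actAt_nonneg _ _ _)
  · simp only [map_sum, crossTerm]
    refine Finset.sum_nonneg fun j _ => Finset.sum_nonneg fun a _ => Finset.sum_nonneg fun b _ => ?_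
    split_ifs
    · exact form_actAt_nonneg _ _ _
    · rw [map_zero]
  · simp only [boundaryTerm, map_sum, map_add]
    exact Finset.sum_nonneg fun a _ =>
      add_nonneg (form_actAt_nonneg _ _ _) (form_actAt_nonneg _ _ _)

/-- The energy of a vector dominates the move energy and the penalties. -/
lemma half_moveWeight_add_penaltyWeight_le {n : ℕ} (hn : 1 ≤ n) (v : Config s (2 * n) → ℂ) :
    2⁻¹ * moveWeight (onWords v) + penaltyWeight (onWords v) ≤
      ENNReal.ofReal (form v (fredkinMatrix s n)) := by
  obtain ⟨h1, h2, h3⟩ := form_nonneg_of_sum_actAt v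
  rw [fredkinMatrix, map_add, map_add, ENNReal.ofReal_add (add_nonneg h1 h2) h3,
    ENNReal.ofReal_add h1 h2, crossWeight_eq hn, boundaryWeight_eq hn, penaltyWeight, add_assoc (ENNReal.ofReal _),
    add_comm (∑' P, ∑' S, _) (_ + _)]
  exact add_le_add_left (half_moveWeight_le hn v) _

/-! ### The lower bound -/

/-- The constant is 288 = 3 · 48 · 2: three kinds of defect, `compConst`, and the half in front of
the move energy. The exponent is 9 = 5 + 4, from `compConst` and the counting of cuts. -/
lemma sum_norm_sq_le_form {n : ℕ} (hn : 1 ≤ n) (v : Config s (2 * n) → ℂ)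
    (hv : ∀ x, IsColoredDyck (List.ofFn x) → v x = 0) :
    ∑ x, ‖v x‖ ^ 2 ≤ 288 * (2 * n + 1) ^ 9 * form v (fredkinMatrix s n) := by
  classical
  have h1 : ENNReal.ofReal (∑ x, ‖v x‖ ^ 2) =
      ∑' w, (if IsColoredDyck w then 0 else weight (onWords v w)) := by
    rw [ENNReal.ofReal_sum_of_nonneg fun _ _ => by positivity]
    have h2 : ∀ w, (if IsColoredDyck w then 0 else weight (onWords v w)) =
        if w.length = 2 * n then
          (if IsColoredDyck w then 0 else weight (onWords v w)) else 0 := by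
      intro w
      by_cases hw : w.length = 2 * n
      · rw [if_pos hw]
      · rw [if_neg hw, onWords_of_length_ne _ _ hw]
        simp [weight]
    rw [tsum_congr h2,
      ← sum_config_eq_tsum (fun w => if IsColoredDyck w then 0 else weight (onWords v w))]
    refine Finset.sum_congr rfl fun x _ => ?_
    rw [onWords_ofFn]
    split_ifs with hx
    · simp [hv x hx]
    · rfl
  have h0 : 0 ≤ form v (fredkinMatrix s n) := by
    obtain ⟨h1, h2, h3⟩ := form_nonneg_of_sum_actAt v
    rw [fredkinMatrix, map_add, map_add]
    exact add_nonneg (add_nonneg h1 h2) h3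
  rw [← ENNReal.ofReal_le_ofReal_iff (mul_nonneg (by positivity) h0), h1]
  refine (tsum_not_dyck_le (onWords_of_length_ne v)).trans ?_
  have h3 : moveWeight (onWords v) + penaltyWeight (onWords v) ≤
      2 * ENNReal.ofReal (form v (fredkinMatrix s n)) := by
    refine le_trans ?_ (mul_le_mul_right (half_moveWeight_add_penaltyWeight_le hn v) 2)
    rw [mul_add, ← mul_assoc, ENNReal.mul_inv_cancel (by norm_num) (by norm_num), one_mul]
    gcongr
    exact le_mul_of_one_le_left zero_le (by norm_num)
  refine (mul_le_mul_right h3 _).trans_eq ?_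
  rw [ENNReal.ofReal_mul (by positivity), ENNReal.ofReal_mul (by positivity),
    ENNReal.ofReal_pow (by positivity), ENNReal.ofReal_add (by positivity) (by norm_num),
    ENNReal.ofReal_mul (by positivity), ENNReal.ofReal_natCast, compConst]
  push_cast
  norm_num
  ring

lemma form_of_eigenvector {n : ℕ} {v : ChainSpace s (2 * n)} {E : ℝ}
    (h : fredkinH s n v = (E : ℂ) • v) :
    form v.ofLp (fredkinMatrix s n) = E * ∑ x, ‖v x‖ ^ 2 := by
  have h1 : fredkinMatrix s n *ᵥ v.ofLp = (E : ℂ) • v.ofLp := congrArg WithLp.ofLp h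
  change (star v.ofLp ⬝ᵥ (fredkinMatrix s n *ᵥ v.ofLp)).re = _
  rw [h1, dotProduct_smul, smul_eq_mul, Complex.re_ofReal_mul]
  congr 1
  rw [dotProduct, Complex.re_sum]
  refine Finset.sum_congr rfl fun x _ => ?_
  rw [Pi.star_apply, Complex.star_def, Complex.conj_mul', ← Complex.ofReal_pow, Complex.ofReal_re]

lemma eigenvalue_lower_bound {n : ℕ} (hn : 1 ≤ n) {v : ChainSpace s (2 * n)} {E : ℝ}
    (hv : v ∈ unbalancedSubspace s n) (hv0 : v ≠ 0) (h : fredkinH s n v = (E : ℂ) • v) :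
    1 / (288 * 3 ^ 9) / (n : ℝ) ^ 9 ≤ E := by
  have h1 := sum_norm_sq_le_form hn v.ofLp ((mem_unbalancedSubspace_iff v).mp hv)
  rw [form_of_eigenvector h] at h1
  have h2 : 0 < ∑ x, ‖v x‖ ^ 2 := by
    rw [← EuclideanSpace.norm_sq_eq]
    have := norm_pos_iff.mpr hv0
    positivity
  have hn' : (1 : ℝ) ≤ n := by exact_mod_cast hn
  have h3 : 1 ≤ 288 * (2 * (n : ℝ) + 1) ^ 9 * E := by
    refine le_of_mul_le_mul_right ?_ h2
    linarith
  -- Positivity allows 2n + 1 to be enlarged to 3n in the factor of `E`.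
  have h4 : 0 < E := by
    by_contra! hE
    have : 288 * (2 * (n : ℝ) + 1) ^ 9 * E ≤ 0 := mul_nonpos_of_nonneg_of_nonpos (by positivity) hE
    linarith
  rw [div_div, div_le_iff₀ (by positivity)]
  refine h3.trans ?_
  have h5 : (2 * (n : ℝ) + 1) ^ 9 ≤ (3 * n) ^ 9 := by
    gcongr
    linarith
  rw [mul_pow] at h5
  calc 288 * (2 * (n : ℝ) + 1) ^ 9 * E ≤ 288 * (3 ^ 9 * n ^ 9) * E := by gcongr
    _ = _ := by ring

lemma unbalancedSubspace_nontrivial {n : ℕ} (hs : 1 ≤ s) (hn : 1 ≤ n) :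
    Nontrivial (unbalancedSubspace s n) := by
  -- A chain of down steps is never Dyck, since the automaton fails at the first site.
  set x : Config s (2 * n) := fun _ => Step.d ⟨0, hs⟩ with hx
  have h1 : ¬ IsColoredDyck (List.ofFn x) := by
    obtain ⟨m, hm⟩ : ∃ m, 2 * n = m + 1 := ⟨2 * n - 1, by omega⟩
    rw [hx, List.ofFn_const, hm, List.replicate_succ, isColoredDyck_iff_stackRun, stackRun_cons]
    simp [stackStep, Step.d, stackRun_none]
  have h2 : EuclideanSpace.single x (1 : ℂ) ∈ unbalancedSubspace s n :=
    Submodule.subset_span ⟨x, h1, rfl⟩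
  refine ⟨⟨⟨_, h2⟩, 0, fun h => ?_⟩⟩
  have h3 := congrArg (fun v : unbalancedSubspace s n => v.1 x) h
  simp at h3

/-- Over ℂ an eigenvalue exists, symmetry makes it real, and finite dimension leaves finitely many
to minimize over. -/
lemma exists_isLeast_eigenvalue {V : Type*} [NormedAddCommGroup V] [InnerProductSpace ℂ V]
    [FiniteDimensional ℂ V] [Nontrivial V] {T : V →ₗ[ℂ] V} (hT : T.IsSymmetric) :
    ∃ E₀ : ℝ, IsLeast {E : ℝ | Module.End.HasEigenvalue T (E : ℂ)} E₀ := by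
  have hfin : {E : ℝ | Module.End.HasEigenvalue T (E : ℂ)}.Finite :=
    (Module.End.finite_hasEigenvalue T).preimage Complex.ofReal_injective.injOn
  have hne : {E : ℝ | Module.End.HasEigenvalue T (E : ℂ)}.Nonempty := by
    obtain ⟨μ, hμ⟩ := Module.End.exists_eigenvalue T
    obtain ⟨E, rfl⟩ := Complex.conj_eq_iff_real.mp (hT.conj_eigenvalue_eq_self hμ)
    exact ⟨E, hμ⟩
  obtain ⟨E₀, hE₀, hmin⟩ := Set.exists_min_image _ id hfin hne
  exact ⟨E₀, hE₀, hmin⟩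

lemma isSymmetric_fredkinH (s n : ℕ) : (fredkinH s n).IsSymmetric :=
  Matrix.isSymmetric_toEuclideanLin_iff.mpr (isSelfAdjoint_fredkinMatrix s n)

end Fredkin

open Fredkin in
theorem mainTheorem4 :
    ∃ (c : ℕ) (C : ℝ), 0 < C ∧ ∀ s n : ℕ, 1 ≤ s → 1 ≤ n →
      ∃ hinv : ∀ v ∈ unbalancedSubspace s n, fredkinH s n v ∈ unbalancedSubspace s n,
      ∃ E₀ : ℝ,
        IsLeast {E : ℝ | Module.End.HasEigenvalue ((fredkinH s n).restrict hinv) (E : ℂ)} E₀ ∧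
        C / (n : ℝ) ^ c ≤ E₀ := by
  refine ⟨9, 1 / (288 * 3 ^ 9), by positivity, fun s n hs hn => ?_⟩
  have hinv : ∀ v ∈ unbalancedSubspace s n, fredkinH s n v ∈ unbalancedSubspace s n :=
    fun v hv => fredkinH_mem_unbalancedSubspace v hv
  have := unbalancedSubspace_nontrivial hs hn
  obtain ⟨E₀, hE₀⟩ :=
    exists_isLeast_eigenvalue ((isSymmetric_fredkinH s n).restrict_invariant hinv)
  refine ⟨hinv, E₀, hE₀, ?_⟩
  obtain ⟨v, hv⟩ := Module.End.HasEigenvalue.exists_hasEigenvector hE₀.1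
  have h1 : fredkinH s n v.1 = (E₀ : ℂ) • v.1 := congrArg Subtype.val hv.apply_eq_smul
  exact eigenvalue_lower_bound hn v.2 (fun h => hv.2 (Subtype.ext h)) h1
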